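/- All manifolds are smooth, real, finite-dimensional, Hausdorff, second countable and without boundary. A foliated manifold $(M,\mathcal F)$ is a manifold $M$ with an involutive smooth vector subbundle $\mathcal F\subseteq TM$ of constant rank; a morphism $f\colon(M,\mathcal F)\to(M',\mathcal F')$ is a smooth map with $d_pf(\mathcal F_p)=\mathcal F'_{f(p)}$ for all $p\in M$. This defines the category $\mathbf{FMn}$; its final object $\star$ is the one-point manifold. $(M,\mathcal F)$ is irreducible if it has a dense leaf. For a morphism $\pi\colon M\to B$ of $\mathbf{FMn}$, ${\rm Aut}_B(M)$ is the group of automorphisms $\sigma$ of $M$ in $\mathbf{FMn}$ with $\pi\circ\sigma=\pi$ (also written ${\rm Aut}_{(B,\mathcal D)}(M,\mathcal F)$), and the kernel pair ${\rm KP}_\pi=M\times_BM\rightrightarrows M$ (formed in $\mathbf{FMn}$) is a groupoid object with source and target the two projections. ${\rm KP}_\pi$ splits if it exists and there are a group object $G$ of $\mathbf{FMn}$ and an action $\alpha\colon G\times M\to M$ in $\mathbf{FMn}$ whose action groupoid $G\ltimes M\rightrightarrows M$ is isomorphic to ${\rm KP}_\pi$ over $M$; $\alpha$ is then called a splitting action.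 A Galois structure for $\pi$ is a splitting action $\alpha$ such that the map $G(\star)={\rm Hom}(\star,G)\to{\rm Aut}_B(M)$, $g\mapsto\alpha(g,\cdot)$, is a group isomorphism. $\pi$ is Galois if it is a categorical quotient of $M$ by the action of the abstract group ${\rm Aut}_B(M)$, and it admits a Galois structure that is unique up to isomorphism (an isomorphism of group objects conjugating the actions). **Theorem.** Let $\pi\colon(M,\mathcal F)\to(B,\mathcal D)$ be a morphism of irreducible foliated manifolds that is a surjective submersion, with ${\rm rank}\,\mathcal F={\rm rank}\,\mathcal D$. The following are equivalent: (a) ${\rm KP}_\pi$ splits in $\mathbf{FMn}$. (b) $\pi$ is Galois in $\mathbf{FMn}$. (c) There is a Lie group $G$ acting smoothly on $M$ such that $\pi$ is a principal $G$-bundle and $\mathcal F$ is a $G$-invariant partial $\mathcal D$-connection, i.e. $d_p\pi$ maps $\mathcal F_p$ isomorphically onto $\mathcal D_{\pi(p)}$ and $d_pL_g(\mathcal F_p)=\mathcal F_{gp}$ for all $p\in M$, $g\in G$, where $L_g(p)=gp$. (d) There is such a Lie group action as in (c), and it is unique: for any two of them, by $G$ and by $H$, there is an isomorphism of Lie groups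 $\varphi\colon G\to H$ with $g\cdot x=\varphi(g)\cdot x$ for all $g\in G$, $x\in M$. Moreover, for every $G$ as in (c), the action gives a group isomorphism $G\cong{\rm Aut}_{(B,\mathcal D)}(M,\mathcal F)$, $g\mapsto(x\mapsto g\cdot x)$. -/

import Mathlib

open CategoryTheory CategoryTheory.Limits
open scoped Manifold ContDiff

/-! ### Group objects, groupoid objects and Galois structures in a category

Internal structures are given on generalized elements, naturally in the test object, so that
only the products that actually occur have to exist in the category. -/

section Categorical

universe v u

variable {C : Type u} [Category.{v} C]

/-- A group object: an object `X` with a group structure on each `Hom(T, X)`, natural in `T`. -/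
structure GroupObject (C : Type u) [Category.{v} C] where
  X : C
  grp : ∀ T : C, Group (T ⟶ X)
  comp_mul : ∀ {S T : C} (f : S ⟶ T) (a b : T ⟶ X), f ≫ (a * b) = (f ≫ a) * (f ≫ b)

attribute [instance] GroupObject.grp

theorem GroupObject.comp_one (G : GroupObject C) {S T : C} (f : S ⟶ T) :
    f ≫ (1 : T ⟶ G.X) = 1 := by
  have h := G.comp_mul f 1 1
  rw [mul_one] at h
  exact left_eq_mul.mp h

theorem GroupObject.comp_inv (G : GroupObject C) {S T : C} (f : S ⟶ T) (a : T ⟶ G.X) :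
    f ≫ a⁻¹ = (f ≫ a)⁻¹ := by
  apply eq_inv_of_mul_eq_one_left
  rw [← G.comp_mul, inv_mul_cancel, G.comp_one]

/-- An action `α : G × M ⟶ M` of a group object `G` on an object `M`, where `G × M` is a
categorical product of `G` and `M`. -/
structure GroupObjectAction (G : GroupObject C) (M : C) where
  prod : C
  fst : prod ⟶ G.X
  snd : prod ⟶ M
  isLimit : IsLimit (BinaryFan.mk fst snd)
  act : prod ⟶ M
  one_act : ∀ {T : C} (x : T ⟶ M),
    BinaryFan.IsLimit.lift isLimit 1 x ≫ act = x
  mul_act : ∀ {T : C} (g h : T ⟶ G.X) (x : T ⟶ M),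
    BinaryFan.IsLimit.lift isLimit (g * h) x ≫ act =
      BinaryFan.IsLimit.lift isLimit g (BinaryFan.IsLimit.lift isLimit h x ≫ act) ≫ act

namespace GroupObjectAction

variable {G : GroupObject C} {M : C} (α : GroupObjectAction G M)

/-- The morphism `⟨g, x⟩ : T ⟶ G × M`. -/
def pair {T : C} (g : T ⟶ G.X) (x : T ⟶ M) : T ⟶ α.prod :=
  BinaryFan.IsLimit.lift α.isLimit g x

@[simp] theorem pair_fst {T : C} (g : T ⟶ G.X) (x : T ⟶ M) : α.pair g x ≫ α.fst = g :=
  BinaryFan.IsLimit.lift_fst α.isLimit g x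

@[simp] theorem pair_snd {T : C} (g : T ⟶ G.X) (x : T ⟶ M) : α.pair g x ≫ α.snd = x :=
  BinaryFan.IsLimit.lift_snd α.isLimit g x

theorem prod_ext {T : C} {p q : T ⟶ α.prod} (h₁ : p ≫ α.fst = q ≫ α.fst)
    (h₂ : p ≫ α.snd = q ≫ α.snd) : p = q :=
  BinaryFan.IsLimit.hom_ext α.isLimit h₁ h₂

/-- The action on generalized elements, `(g, x) ↦ α ∘ ⟨g, x⟩`. -/
def smul {T : C} (g : T ⟶ G.X) (x : T ⟶ M) : T ⟶ M := α.pair g x ≫ α.act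

theorem one_smul' {T : C} (x : T ⟶ M) : α.smul 1 x = x := α.one_act x

theorem mul_smul' {T : C} (g h : T ⟶ G.X) (x : T ⟶ M) :
    α.smul (g * h) x = α.smul g (α.smul h x) := α.mul_act g h x

theorem comp_pair {S T : C} (f : S ⟶ T) (g : T ⟶ G.X) (x : T ⟶ M) :
    f ≫ α.pair g x = α.pair (f ≫ g) (f ≫ x) := by
  apply α.prod_ext <;> simp

theorem comp_smul {S T : C} (f : S ⟶ T) (g : T ⟶ G.X) (x : T ⟶ M) :
    f ≫ α.smul g x = α.smul (f ≫ g) (f ≫ x) := by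
  unfold smul
  rw [← Category.assoc, comp_pair]

theorem comp_act {T : C} (p : T ⟶ α.prod) :
    p ≫ α.act = α.smul (p ≫ α.fst) (p ≫ α.snd) := by
  unfold smul
  congr 1
  apply α.prod_ext <;> simp

end GroupObjectAction

/-- A groupoid object `A ⇉ X` with source `s` and target `t`; `comp b a` is the composite
"first `a`, then `b`" of generalized arrows. -/
structure GroupoidObject (X : C) where
  A : C
  s : A ⟶ X
  t : A ⟶ X
  unit : X ⟶ A
  inv : A ⟶ A
  comp : ∀ {T : C} (b a : T ⟶ A), a ≫ t = b ≫ s → (T ⟶ A)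
  comp_natural : ∀ {S T : C} (f : S ⟶ T) (b a : T ⟶ A) (h : a ≫ t = b ≫ s)
    (h' : (f ≫ a) ≫ t = (f ≫ b) ≫ s), f ≫ comp b a h = comp (f ≫ b) (f ≫ a) h'
  unit_s : unit ≫ s = 𝟙 X
  unit_t : unit ≫ t = 𝟙 X
  comp_s : ∀ {T : C} (b a : T ⟶ A) (h : a ≫ t = b ≫ s), comp b a h ≫ s = a ≫ s
  comp_t : ∀ {T : C} (b a : T ⟶ A) (h : a ≫ t = b ≫ s), comp b a h ≫ t = b ≫ t
  comp_unit : ∀ {T : C} (a : T ⟶ A) (h : ((a ≫ s) ≫ unit) ≫ t = a ≫ s),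
    comp a ((a ≫ s) ≫ unit) h = a
  unit_comp : ∀ {T : C} (a : T ⟶ A) (h : a ≫ t = ((a ≫ t) ≫ unit) ≫ s),
    comp ((a ≫ t) ≫ unit) a h = a
  assoc : ∀ {T : C} (c b a : T ⟶ A) (h₁ : a ≫ t = b ≫ s) (h₂ : b ≫ t = c ≫ s)
    (h₃ : comp b a h₁ ≫ t = c ≫ s) (h₄ : a ≫ t = comp c b h₂ ≫ s),
    comp c (comp b a h₁) h₃ = comp (comp c b h₂) a h₄
  inv_s : inv ≫ s = t
  inv_t : inv ≫ t = s
  inv_comp : ∀ {T : C} (a : T ⟶ A) (h : a ≫ t = (a ≫ inv) ≫ s),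
    comp (a ≫ inv) a h = (a ≫ s) ≫ unit
  comp_inv : ∀ {T : C} (a : T ⟶ A) (h : (a ≫ inv) ≫ t = a ≫ s),
    comp a (a ≫ inv) h = (a ≫ t) ≫ unit

/-- An isomorphism of groupoid objects over the same object of objects (identity on objects). -/
structure GroupoidObject.Iso {X : C} (𝒢 ℋ : GroupoidObject X) where
  iso : 𝒢.A ≅ ℋ.A
  map_s : iso.hom ≫ ℋ.s = 𝒢.s
  map_t : iso.hom ≫ ℋ.t = 𝒢.t
  map_comp : ∀ {T : C} (b a : T ⟶ 𝒢.A) (h : a ≫ 𝒢.t = b ≫ 𝒢.s)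
    (h' : (a ≫ iso.hom) ≫ ℋ.t = (b ≫ iso.hom) ≫ ℋ.s),
    𝒢.comp b a h ≫ iso.hom = ℋ.comp (b ≫ iso.hom) (a ≫ iso.hom) h'

/-- The action groupoid `G ⋉ M ⇉ M`: `s(g,x) = x`, `t(g,x) = g x`,
`(h, g x) ∘ (g, x) = (h g, x)`. -/
def GroupObjectAction.groupoid {G : GroupObject C} {M : C} (α : GroupObjectAction G M) :
    GroupoidObject M where
  A := α.prod
  s := α.snd
  t := α.act
  unit := α.pair 1 (𝟙 M)
  inv := α.pair α.fst⁻¹ α.act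
  comp b a _ := α.pair ((b ≫ α.fst) * (a ≫ α.fst)) (a ≫ α.snd)
  comp_natural f b a h h' := by
    rw [α.comp_pair, G.comp_mul]; simp
  unit_s := by simp
  unit_t := α.one_smul' _
  comp_s b a h := by simp
  comp_t b a h := by
    rw [α.comp_act, α.pair_fst, α.pair_snd, α.mul_smul', ← α.comp_act a, h, ← α.comp_act]
  comp_unit a h := by
    apply α.prod_ext <;> simp [G.comp_one]
  unit_comp a h := by
    apply α.prod_ext <;> simp [G.comp_one]
  assoc c b a h₁ h₂ h₃ h₄ := by
    simp [mul_assoc]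
  inv_s := by simp
  inv_t := by
    rw [α.comp_act, α.pair_fst, α.pair_snd]
    have h : α.act = α.smul α.fst α.snd := by
      simpa using α.comp_act (𝟙 _)
    rw [h, ← α.mul_smul', inv_mul_cancel, α.one_smul']
  inv_comp a h := by
    apply α.prod_ext <;> simp [G.comp_one, G.comp_inv]
  comp_inv a h := by
    apply α.prod_ext <;> simp [G.comp_one, G.comp_inv]

/-- The kernel pair `M ×_B M ⇉ M` of `π`, as a groupoid object; the source and the target are
the first and the second projection. -/
noncomputable def kernelPairGroupoid {M B K : C} {π : M ⟶ B} {s t : K ⟶ M}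
    (h : IsKernelPair π s t) : GroupoidObject M where
  A := K
  s := s
  t := t
  unit := h.lift (𝟙 M) (𝟙 M) rfl
  inv := h.lift t s h.w.symm
  comp b a e := h.lift (a ≫ s) (b ≫ t) (by
    rw [Category.assoc, h.w, ← Category.assoc, e, Category.assoc, h.w, ← Category.assoc])
  comp_natural f b a e e' := by
    apply h.hom_ext <;> simp
  unit_s := by simp
  unit_t := by simp
  comp_s b a e := by simp
  comp_t b a e := by simp
  comp_unit a e := by
    apply h.hom_ext <;> simp
  unit_comp a e := by
    apply h.hom_ext <;> simp
  assoc c b a h₁ h₂ h₃ h₄ := by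
    apply h.hom_ext <;> simp
  inv_s := by simp
  inv_t := by simp
  inv_comp a e := by
    apply h.hom_ext <;> simp
  comp_inv a e := by
    apply h.hom_ext <;> simp

/-- `α` is a splitting action for the groupoid object `𝒢`. -/
def GroupObjectAction.IsSplitting {G : GroupObject C} {M : C} (α : GroupObjectAction G M)
    (𝒢 : GroupoidObject M) : Prop :=
  Nonempty (GroupoidObject.Iso α.groupoid 𝒢)

/-- A groupoid object splits if it is isomorphic to an action groupoid. -/
def GroupoidObject.Splits {M : C} (𝒢 : GroupoidObject M) : Prop :=
  ∃ (G : GroupObject C) (α : GroupObjectAction G M), α.IsSplitting 𝒢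

/-- The kernel pair of `π` exists and, as a groupoid object, it splits. -/
def KernelPairSplits {M B : C} (π : M ⟶ B) : Prop :=
  ∃ (K : C) (s t : K ⟶ M) (h : IsKernelPair π s t), (kernelPairGroupoid h).Splits

/-- `Aut_B(M)`, the group of automorphisms `σ` of `M` with `π ∘ σ = π`. -/
def AutOver {M B : C} (π : M ⟶ B) : Subgroup (Aut M) where
  carrier := {σ | σ.hom ≫ π = π}
  one_mem' := Category.id_comp π
  mul_mem' {σ τ} hσ hτ := by
    change (τ.hom ≫ σ.hom) ≫ π = π
    rw [Category.assoc, show σ.hom ≫ π = π from hσ, show τ.hom ≫ π = π from hτ]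
  inv_mem' {σ} hσ := by
    change σ.inv ≫ π = π
    exact (Iso.inv_comp_eq (σ : M ≅ M)).mpr (show σ.hom ≫ π = π from hσ).symm

/-- `q : X ⟶ Y` is a categorical quotient of the action `φ` of a group on `X`. -/
def IsCategoricalQuotient {H : Type*} [Group H] {X Y : C} (φ : H →* Aut X) (q : X ⟶ Y) : Prop :=
  (∀ g : H, (φ g).hom ≫ q = q) ∧
    ∀ (Z : C) (f : X ⟶ Z), (∀ g : H, (φ g).hom ≫ f = f) → ∃! f' : Y ⟶ Z, q ≫ f' = f

/-- `π : M ⟶ B` is normal if it is the categorical quotient of `M` by `Aut_B(M)`. -/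
def IsNormalEpimorphism {M B : C} (π : M ⟶ B) : Prop :=
  IsCategoricalQuotient (AutOver π).subtype π

/-- `α` is a Galois structure for `π`: a splitting action for the kernel pair of `π` such that
`g ↦ α_g = α ∘ ⟨g, Id⟩` is a group isomorphism `G(⋆) ≅ Aut_B(M)`, where `⋆` is a final
object. -/
def IsGaloisStructure {pt : C} (hpt : IsTerminal pt) {M B : C} (π : M ⟶ B)
    {G : GroupObject C} (α : GroupObjectAction G M) : Prop :=
  (∃ (K : C) (s t : K ⟶ M) (h : IsKernelPair π s t), α.IsSplitting (kernelPairGroupoid h)) ∧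
    ∃ Φ : (pt ⟶ G.X) ≃* AutOver π,
      ∀ g : pt ⟶ G.X, (Φ g : Aut M).hom = α.smul (hpt.from M ≫ g) (𝟙 M)

/-- Isomorphism of actions on `M`: an isomorphism of the group objects that conjugates the
actions. -/
def GroupObjectAction.Isomorphic {G H : GroupObject C} {M : C} (α : GroupObjectAction G M)
    (β : GroupObjectAction H M) : Prop :=
  ∃ φ : G.X ≅ H.X,
    (∀ {T : C} (a b : T ⟶ G.X), (a * b) ≫ φ.hom = (a ≫ φ.hom) * (b ≫ φ.hom)) ∧
    ∀ {T : C} (g : T ⟶ G.X) (x : T ⟶ M), α.smul g x = β.smul (g ≫ φ.hom) x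

/-- `π` is Galois: it is normal and admits a Galois structure, unique up to isomorphism. -/
def IsGaloisEpimorphism {pt : C} (hpt : IsTerminal pt) {M B : C} (π : M ⟶ B) : Prop :=
  IsNormalEpimorphism π ∧
    (∃ (G : GroupObject C) (α : GroupObjectAction G M), IsGaloisStructure hpt π α) ∧
    ∀ (G H : GroupObject C) (α : GroupObjectAction G M) (β : GroupObjectAction H M),
      IsGaloisStructure hpt π α → IsGaloisStructure hpt π β → α.Isomorphic β

end Categorical

/-! ### Foliated manifolds -/

section Foliations

variable {E : Type} [NormedAddCommGroup E] [NormedSpace ℝ E] {H : Type} [TopologicalSpace H]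

/-- A regular foliation: an involutive smooth linear subbundle, of rank `rank`, of the tangent
bundle of `M`. -/
structure Foliation (I : ModelWithCorners ℝ E H) (M : Type) [TopologicalSpace M]
    [ChartedSpace H M] [IsManifold I ∞ M] where
  rank : ℕ
  D : ∀ p : M, Submodule ℝ (TangentSpace I p)
  exists_frame : ∀ p : M, ∃ U : Set M, IsOpen U ∧ p ∈ U ∧
    ∃ X : Fin rank → ∀ q : M, TangentSpace I q,
      (∀ i, ContMDiffOn I I.tangent ∞ (fun q => (⟨q, X i q⟩ : TangentBundle I M)) U) ∧
      ∀ q ∈ U, LinearIndependent ℝ (fun i => X i q) ∧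
        Submodule.span ℝ (Set.range fun i => X i q) = D q
  involutive : ∀ U : Set M, IsOpen U → ∀ X Y : ∀ q : M, TangentSpace I q,
    ContMDiffOn I I.tangent ∞ (fun q => (⟨q, X q⟩ : TangentBundle I M)) U →
    ContMDiffOn I I.tangent ∞ (fun q => (⟨q, Y q⟩ : TangentBundle I M)) U →
    (∀ q ∈ U, X q ∈ D q) → (∀ q ∈ U, Y q ∈ D q) →
    ∀ q ∈ U, VectorField.mlieBracket I X Y q ∈ D q

/-- The leaf through `p`: the points that can be joined to `p` by a smooth curve tangent to the
foliation. -/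
def Foliation.leaf {I : ModelWithCorners ℝ E H} {M : Type} [TopologicalSpace M]
    [ChartedSpace H M] [IsManifold I ∞ M] (F : Foliation I M) (p : M) : Set M :=
  {q | ∃ γ : ℝ → M, ContMDiff 𝓘(ℝ, ℝ) I ∞ γ ∧
    (∀ t : ℝ, mfderiv 𝓘(ℝ, ℝ) I γ t (1 : ℝ) ∈ F.D (γ t)) ∧ γ 0 = p ∧ γ 1 = q}

end Foliations

/-- An object of the category `FMn`: a smooth manifold (finite-dimensional, without boundary,
Hausdorff, second countable) endowed with a regular foliation. -/
structure FMn : Type 1 where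
  E : Type
  [normedE : NormedAddCommGroup E]
  [spaceE : NormedSpace ℝ E]
  [finE : FiniteDimensional ℝ E]
  H : Type
  [topH : TopologicalSpace H]
  I : ModelWithCorners ℝ E H
  [boundaryless : I.Boundaryless]
  carrier : Type
  [top : TopologicalSpace carrier]
  [charted : ChartedSpace H carrier]
  [isManifold : IsManifold I ∞ carrier]
  [t2 : T2Space carrier]
  [secondCountable : SecondCountableTopology carrier]
  fol : Foliation I carrier

namespace FMn

attribute [instance] normedE spaceE finE topH boundaryless top charted isManifold t2
  secondCountable

instance : CoeSort FMn Type := ⟨FMn.carrier⟩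

/-- The differential of a map between foliated manifolds. -/
noncomputable def diff {M N : FMn} (f : M → N) (p : M) :
    TangentSpace M.I p →ₗ[ℝ] TangentSpace N.I (f p) :=
  (mfderiv M.I N.I f p).toLinearMap

/-- A morphism of foliated manifolds: a smooth map whose differential maps the foliation onto
the foliation, at each point. -/
@[ext]
structure Hom (M N : FMn) where
  toFun : M → N
  contMDiff : ContMDiff M.I N.I ∞ toFun
  map_fol : ∀ p : M, (M.fol.D p).map (diff toFun p) = N.fol.D (toFun p)

theorem diff_id (M : FMn) (p : M) : diff (id : M → M) p = LinearMap.id := by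
  unfold diff
  rw [mfderiv_id]
  rfl

theorem diff_comp {M N P : FMn} {g : N → P} {f : M → N} (hg : ContMDiff N.I P.I ∞ g)
    (hf : ContMDiff M.I N.I ∞ f) (p : M) :
    diff (g ∘ f) p = (diff g (f p)).comp (diff f p) := by
  unfold diff
  rw [mfderiv_comp p ((hg (f p)).mdifferentiableAt (by simp))
    ((hf p).mdifferentiableAt (by simp))]
  rfl

noncomputable instance : Category FMn where
  Hom := Hom
  id M := ⟨id, contMDiff_id, fun p => by rw [diff_id]; exact Submodule.map_id _⟩
  comp f g := ⟨g.toFun ∘ f.toFun, g.contMDiff.comp f.contMDiff, fun p => by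
    rw [diff_comp g.contMDiff f.contMDiff, Submodule.map_comp, f.map_fol, g.map_fol]
    rfl⟩

/-- The underlying map of a morphism. -/
def fn {M N : FMn} (f : M ⟶ N) : M → N := Hom.toFun f

/-- The one-point manifold, with its only foliation. -/
noncomputable def point : FMn where
  E := PUnit
  H := PUnit
  I := 𝓘(ℝ, PUnit)
  carrier := PUnit
  fol :=
    { rank := 0
      D := fun _ => ⊥
      exists_frame := fun p => ⟨Set.univ, isOpen_univ, trivial, fun i => i.elim0,
        fun i => i.elim0, fun q _ => ⟨linearIndependent_empty_type, by simp⟩⟩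
      involutive := fun _ _ _ _ _ _ _ _ q _ => by
        rw [Submodule.mem_bot]
        exact Subsingleton.elim (α := PUnit) _ _ }

/-- The one-point manifold is a final object of `FMn`. -/
noncomputable def pointIsTerminal : IsTerminal point :=
  IsTerminal.ofUniqueHom
    (fun M => (⟨fun _ => PUnit.unit, contMDiff_const, fun p => by
      refine SetLike.ext fun x => ?_
      exact iff_of_true ⟨0, Submodule.zero_mem _, Subsingleton.elim (α := PUnit) _ _⟩
        (Subsingleton.elim (α := PUnit) _ _)⟩ : Hom M point))
    (fun M f => by
      apply Hom.ext
      funext x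
      exact Subsingleton.elim (α := PUnit) _ _)

/-- A foliated manifold is irreducible if it has a dense leaf. -/
def Irreducible (M : FMn) : Prop := ∃ p : M, Dense (M.fol.leaf p)

end FMn

/-! ### Principal bundles with invariant partial connections -/

/-- Real Lie groups (finite-dimensional, Hausdorff, second countable). -/
structure RealLieGroup : Type 1 where
  E : Type
  [normedE : NormedAddCommGroup E]
  [spaceE : NormedSpace ℝ E]
  [finE : FiniteDimensional ℝ E]
  H : Type
  [topH : TopologicalSpace H]
  I : ModelWithCorners ℝ E H
  [boundaryless : I.Boundaryless]
  carrier : Type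
  [grp : Group carrier]
  [top : TopologicalSpace carrier]
  [charted : ChartedSpace H carrier]
  [lie : LieGroup I ∞ carrier]
  [t2 : T2Space carrier]
  [secondCountable : SecondCountableTopology carrier]

namespace RealLieGroup

attribute [instance] normedE spaceE finE topH boundaryless grp top charted lie t2
  secondCountable

instance : CoeSort RealLieGroup Type := ⟨RealLieGroup.carrier⟩

end RealLieGroup

/-- `π : M ⟶ B` is a principal `G`-bundle for the given smooth action of `G` on `M`: over a
neighbourhood `U` of each point of `B` there is a `G`-equivariant diffeomorphism
`π⁻¹(U) ≅ U × G` over `U`. -/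
structure IsPrincipalBundle {M B : FMn} (π : M ⟶ B) (G : RealLieGroup) [MulAction G M] :
    Prop where
  smooth_action : ContMDiffSMul G.I M.I ∞ G M
  locally_trivial : ∀ b : B, ∃ U : Set B, IsOpen U ∧ b ∈ U ∧
    ∃ Φ : PartialDiffeomorph M.I (B.I.prod G.I) M (B × G) ∞,
      Φ.source = FMn.fn π ⁻¹' U ∧ Φ.target = U ×ˢ Set.univ ∧
      ∀ x ∈ Φ.source, (Φ x).1 = FMn.fn π x ∧
        ∀ g : G, g • x ∈ Φ.source ∧ Φ (g • x) = ((Φ x).1, g * (Φ x).2)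

/-- The foliation of `M` is a flat partial connection in the direction of the foliation of `B`:
`dπ` maps `F_p` isomorphically onto `D_{π p}` for each `p`. -/
def IsPartialConnection {M B : FMn} (π : M ⟶ B) : Prop :=
  ∀ p : M, Set.BijOn (FMn.diff (FMn.fn π) p) (M.fol.D p) (B.fol.D (FMn.fn π p))

/-- The foliation of `M` is invariant under the action of `G`: `d_p L_g (F_p) = F_{g p}`. -/
def IsInvariantFoliation (M : FMn) (G : Type) [Group G] [MulAction G M] : Prop :=
  ∀ (g : G) (p : M),
    (M.fol.D p).map (FMn.diff (fun x : M => g • x) p) = M.fol.D (g • p)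

/-- A Lie group `G` acting on `M` such that `π` is a principal `G`-bundle and the foliation of
`M` is a `G`-invariant partial connection in the direction of the foliation of `B`. -/
structure PrincipalStructure {M B : FMn} (π : M ⟶ B) where
  G : RealLieGroup
  [action : MulAction G M]
  principal : IsPrincipalBundle π G
  connection : IsPartialConnection π
  invariant : IsInvariantFoliation M G

attribute [instance] PrincipalStructure.action

/-- Two principal structures are isomorphic: there is an isomorphism of Lie groups that
conjugates the actions. -/
def PrincipalStructure.Isomorphic {M B : FMn} {π : M ⟶ B} (P Q : PrincipalStructure π) : Prop :=
  ∃ φ : P.G ≃* Q.G,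
    ContMDiff P.G.I Q.G.I ∞ φ ∧ ContMDiff Q.G.I P.G.I ∞ φ.symm ∧
    ∀ (g : P.G) (x : M), g • x = φ g • x

/-! The theorem rests on the rigidity of morphisms that map foliation onto foliation. The unit `⋆ ⟶
G` of a group object forces the foliation of `G` to have rank zero, so group objects are Lie groups
(`GroupObject.rank_eq_zero`). A morphism to a manifold of rank zero kills the foliation directions,
so it is constant along leaves, and constant outright when some leaf is dense (`FMn.fn_eq_const`).

Let `G` be as in (c), and let `f` and `h` be morphisms `T ⟶ M` with the same projection to `B`.
There is a unique map `k : T → G` with `k • f = h`, and local trivializations show that it is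
smooth. By the product rule, `dh(v)` is the translate of `df(v)` plus a vertical vector coming from
`dk(v)`. For `v` in the foliation, invariance puts this vertical vector in `F`; since `dπ` is
injective on `F` it vanishes, hence so does `dk(v)`. So `k` is a morphism
(`PrincipalStructure.exists_hom_smul_eq`), which says that `G × M` is the kernel pair of `π`. With
`f` the identity and `h` an automorphism over `B`, `k` is constant by density of a leaf: `G` is the
automorphism group. Two principal structures are then both identified with the same abstract group,
and comparing their orbit maps shows that the resulting isomorphism is smooth. Since `G` is
transitive on fibres and `π` has local sections, `π` is a categorical quotient.

Conversely, a splitting action divides generalized elements of `M` uniquely, but when the foliation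
has positive rank the points of `M` are not morphisms from `⋆`. One tests instead with foliated
Euclidean spaces modelling `M ×_B M` near a pair of points (`FMn.exists_local_kernel_pair`);
equality of ranks makes `dπ` an isomorphism from `F` to `D`, so that both projections of the model
are morphisms. The universal property then yields a smooth division map near each pair of points in
a fibre (`GroupObjectAction.exists_local_division`), and translating local sections of `π` by `G`
gives trivializations.

Products and test objects need involutive pullbacks. The criterion used is that a foliation is
locally the kernel of a family `Q` of linear maps with `dQ(v) w = dQ(w) v` on the kernel; this
condition is stable under pullback and intersection (`IsLocalKernel.pullback`, `IsLocalKernel.inf`).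
-/

/-! ### Smooth families of subspaces of a vector space -/

section LinearFamilies

open Topology Filter

variable {E E₁ : Type*} [NormedAddCommGroup E] [NormedSpace ℝ E]
  [NormedAddCommGroup E₁] [NormedSpace ℝ E₁]

/-- A smooth family of endomorphisms which is the identity at `z₀` is invertible near `z₀`, and its
inverse is smooth. -/
theorem eventually_isUnit_of_eq_one [FiniteDimensional ℝ E₁] {S : E → E₁ →L[ℝ] E₁} {z₀ : E}
    (hS : ∀ᶠ z in 𝓝 z₀, ContDiffAt ℝ ∞ S z) (h₀ : S z₀ = 1) :
    ∀ᶠ z in 𝓝 z₀, ContDiffAt ℝ ∞ (fun z => Ring.inverse (S z)) z ∧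
      (∀ v, Ring.inverse (S z) (S z v) = v) ∧ ∀ v, S z (Ring.inverse (S z) v) = v := by
  have : CompleteSpace E₁ := FiniteDimensional.complete ℝ E₁
  have h1 : ∀ᶠ A : E₁ →L[ℝ] E₁ in 𝓝 (S z₀), IsUnit A := by
    rw [h₀]
    exact Units.nhds (1 : (E₁ →L[ℝ] E₁)ˣ)
  filter_upwards [hS, hS.self_of_nhds.continuousAt.eventually h1] with z hSz hz
  refine ⟨?_, fun v => congrArg (fun A : E₁ →L[ℝ] E₁ => A v) (Ring.inverse_mul_cancel _ hz),
    fun v => congrArg (fun A : E₁ →L[ℝ] E₁ => A v) (Ring.mul_inverse_cancel _ hz)⟩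
  refine ContDiffAt.comp (g := Ring.inverse) z ?_ hSz
  obtain ⟨u, hu⟩ := hz
  rw [← hu]
  exact contDiffAt_ringInverse ℝ u

/-- The span of a smooth frame is the kernel of a smooth family of endomorphisms. -/
theorem exists_ker_eq_span [FiniteDimensional ℝ E] {r : ℕ} {X : Fin r → E → E} {z₀ : E}
    (hX : ∀ᶠ z in 𝓝 z₀, ∀ i, ContDiffAt ℝ ∞ (X i) z) (hli : LinearIndependent ℝ fun i => X i z₀) :
    ∃ P : E → E →L[ℝ] E, (∀ᶠ z in 𝓝 z₀, ContDiffAt ℝ ∞ P z) ∧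
      ∀ᶠ z in 𝓝 z₀, ∀ v, P z v = 0 ↔ v ∈ Submodule.span ℝ (Set.range fun i => X i z) := by
  let Ξ : E → (Fin r → ℝ) →L[ℝ] E := fun z =>
    ∑ i, (ContinuousLinearMap.proj (R := ℝ) (φ := fun _ : Fin r => ℝ) i).smulRight (X i z)
  have hΞ_apply : ∀ z c, Ξ z c = ∑ i, c i • X i z := fun z c => by simp [Ξ]
  have hΞ : ∀ᶠ z in 𝓝 z₀, ContDiffAt ℝ ∞ Ξ z := by
    filter_upwards [hX] with z hXz
    refine ContDiffAt.sum fun i _ => ?_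
    exact ContDiffAt.smulRight contDiffAt_const (hXz i)
  have hinj : LinearMap.ker (Ξ z₀).toLinearMap = ⊥ := by
    rw [LinearMap.ker_eq_bot']
    intro c hc
    rw [ContinuousLinearMap.coe_coe, hΞ_apply] at hc
    exact funext (Fintype.linearIndependent_iff.mp hli c hc)
  obtain ⟨L, hL⟩ := LinearMap.exists_leftInverse_of_injective _ hinj
  have hL' : ∀ c, L (Ξ z₀ c) = c := fun c => LinearMap.congr_fun hL c
  let Lc : E →L[ℝ] (Fin r → ℝ) := LinearMap.toContinuousLinearMap L
  let S : E → (Fin r → ℝ) →L[ℝ] (Fin r → ℝ) := fun z => Lc.comp (Ξ z)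
  have hS : ∀ᶠ z in 𝓝 z₀, ContDiffAt ℝ ∞ S z := hΞ.mono fun z h => contDiffAt_const.clm_comp h
  have hS₀ : S z₀ = 1 := by
    ext1 c
    exact hL' c
  have hev := eventually_isUnit_of_eq_one hS hS₀
  -- Since `L` inverts `Ξ z₀` on the left, `S z = L ∘ Ξ z` stays invertible near `z₀`. Then `Ξ z ∘
  -- (S z)⁻¹ ∘ L` is a projection onto the span of the frame, and `P z` is the complementary
  -- projection.
  refine ⟨fun z => ContinuousLinearMap.id ℝ E - (Ξ z).comp ((Ring.inverse (S z)).comp Lc), ?_, ?_⟩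
  · filter_upwards [hΞ, hev] with z hΞz hz
    exact contDiffAt_const.sub (hΞz.clm_comp (hz.1.clm_comp contDiffAt_const))
  · filter_upwards [hev] with z hz v
    have hmem : ∀ u, u ∈ Submodule.span ℝ (Set.range fun i => X i z) ↔ ∃ c, Ξ z c = u := by
      intro u
      rw [Submodule.mem_span_range_iff_exists_fun]
      simp only [hΞ_apply]
    rw [hmem]
    have hz' : ∀ c, Ring.inverse (S z) (Lc (Ξ z c)) = c := hz.2.1
    constructor
    · intro h
      exact ⟨Ring.inverse (S z) (Lc v), (sub_eq_zero.mp h).symm⟩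
    · rintro ⟨c, rfl⟩
      change Ξ z c - Ξ z (Ring.inverse (S z) (Lc (Ξ z c))) = 0
      rw [hz', sub_self]

/-- The kernels of a smooth family of linear maps, if they have constant rank, are spanned by a
smooth frame. -/
theorem exists_frame_of_finrank_ker [FiniteDimensional ℝ E] [FiniteDimensional ℝ E₁] {r : ℕ} {Q : E → E →L[ℝ] E₁} {z₀ : E}
    (hQ : ∀ᶠ z in 𝓝 z₀, ContDiffAt ℝ ∞ Q z)
    (hr : ∀ᶠ z in 𝓝 z₀, Module.finrank ℝ (LinearMap.ker (Q z).toLinearMap) = r) :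
    ∃ X : Fin r → E → E, (∀ᶠ z in 𝓝 z₀, ∀ i, ContDiffAt ℝ ∞ (X i) z) ∧
      ∀ᶠ z in 𝓝 z₀, LinearIndependent ℝ (fun i => X i z) ∧
        Submodule.span ℝ (Set.range fun i => X i z) = LinearMap.ker (Q z).toLinearMap := by
  have hr₀ := hr.self_of_nhds
  let K := LinearMap.ker (Q z₀).toLinearMap
  let b := Module.finBasisOfFinrankEq ℝ K hr₀
  obtain ⟨g, hg⟩ := (Q z₀).toLinearMap.rangeRestrict.exists_rightInverse_of_surjective
    (LinearMap.range_rangeRestrict _)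
  obtain ⟨R, hR⟩ := LinearMap.exists_extend g
  have hQR : ∀ v, Q z₀ (R (Q z₀ v)) = Q z₀ v := by
    intro v
    have h1 : R (Q z₀ v) = g ((Q z₀).toLinearMap.rangeRestrict v) :=
      LinearMap.congr_fun hR ((Q z₀).toLinearMap.rangeRestrict v)
    rw [h1]
    exact congrArg Subtype.val (LinearMap.congr_fun hg ((Q z₀).toLinearMap.rangeRestrict v))
  let Rc : E₁ →L[ℝ] E := LinearMap.toContinuousLinearMap R
  -- `R` satisfies `Q₀ R Q₀ = Q₀`, so `1 - R Q₀` takes values in `ker Q₀`. On `ker (Q z)` the map `S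
  -- z` reduces to `1 - R Q₀`; it therefore sends `ker (Q z)` into `ker Q₀`, onto it by constancy of
  -- the rank, and its inverse transports a fixed basis of `ker Q₀`.
  let S : E → E →L[ℝ] E := fun z => Rc.comp (Q z) + (ContinuousLinearMap.id ℝ E - Rc.comp (Q z₀))
  have hS_apply : ∀ z v, S z v = R (Q z v) + (v - R (Q z₀ v)) := fun z v => rfl
  have hS : ∀ᶠ z in 𝓝 z₀, ContDiffAt ℝ ∞ S z :=
    hQ.mono fun z h => (contDiffAt_const.clm_comp h).add contDiffAt_const
  have hS₀ : S z₀ = 1 := by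
    ext1 v
    rw [hS_apply]
    simp
  have hev := eventually_isUnit_of_eq_one hS hS₀
  refine ⟨fun i z => Ring.inverse (S z) (b i), hev.mono fun z hz i => hz.1.clm_apply contDiffAt_const, ?_⟩
  filter_upwards [hev, hr] with z hz hrz
  have hinjS : Function.Injective (S z) := Function.LeftInverse.injective hz.2.1
  have hinj : Function.Injective fun v => Ring.inverse (S z) v := Function.LeftInverse.injective hz.2.2
  have hmaps : ∀ v ∈ LinearMap.ker (Q z).toLinearMap, S z v ∈ K := by
    intro v hv
    rw [LinearMap.mem_ker, ContinuousLinearMap.coe_coe] at hv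
    rw [hS_apply, hv, map_zero, zero_add]
    change Q z₀ (v - R (Q z₀ v)) = 0
    rw [map_sub, hQR, sub_self]
  have hmap : (LinearMap.ker (Q z).toLinearMap).map (S z).toLinearMap = K := by
    apply Submodule.eq_of_le_of_finrank_eq
    · rintro _ ⟨v, hv, rfl⟩
      exact hmaps v hv
    · rw [← (Submodule.equivMapOfInjective (S z).toLinearMap hinjS _).finrank_eq, hrz, hr₀]
  have hli : LinearIndependent ℝ (fun i => Ring.inverse (S z) (b i : E)) := by
    have h1 : LinearIndependent ℝ (fun i => (b i : E)) :=
      b.linearIndependent.map' K.subtype (Submodule.ker_subtype K)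
    exact h1.map' (Ring.inverse (S z)).toLinearMap (LinearMap.ker_eq_bot.mpr hinj)
  refine ⟨hli, ?_⟩
  apply Submodule.eq_of_le_of_finrank_eq
  · rw [Submodule.span_le]
    rintro _ ⟨i, rfl⟩
    obtain ⟨v, hv, hvi⟩ : (b i : E) ∈ (LinearMap.ker (Q z).toLinearMap).map (S z).toLinearMap := by
      rw [hmap]
      exact (b i).2
    have : Ring.inverse (S z) (b i : E) = v := by
      rw [← hvi]
      exact hz.2.1 v
    change Ring.inverse (S z) (b i : E) ∈ _
    rw [this]
    exact hv
  · rw [finrank_span_eq_card hli, hrz, Fintype.card_fin]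

/-- The Lie bracket of two vector fields annihilated by a differentiable family of linear maps. -/
theorem apply_lieBracket_of_apply_eq_zero {Q : E → E →L[ℝ] E₁} {V W : E → E} {z₀ : E}
    (hQ : DifferentiableAt ℝ Q z₀) (hV : DifferentiableAt ℝ V z₀) (hW : DifferentiableAt ℝ W z₀)
    (hQV : ∀ᶠ z in 𝓝 z₀, Q z (V z) = 0) (hQW : ∀ᶠ z in 𝓝 z₀, Q z (W z) = 0) :
    Q z₀ (VectorField.lieBracket ℝ V W z₀) =
      fderiv ℝ Q z₀ (W z₀) (V z₀) - fderiv ℝ Q z₀ (V z₀) (W z₀) := by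
  -- Differentiating `Q(U) = 0` trades the derivative of the field for that of `Q`, so the bracket
  -- depends only on the values of the fields at `z₀`.
  have key : ∀ {U : E → E}, DifferentiableAt ℝ U z₀ → (∀ᶠ z in 𝓝 z₀, Q z (U z) = 0) →
      ∀ v, Q z₀ (fderiv ℝ U z₀ v) = - fderiv ℝ Q z₀ v (U z₀) := by
    intro U hU hQU v
    have h1 := (hQ.hasFDerivAt.clm_apply hU.hasFDerivAt).fderiv
    have h2 : fderiv ℝ (fun z => Q z (U z)) z₀ = 0 := by
      have : (fun z => Q z (U z)) =ᶠ[𝓝 z₀] fun _ => 0 := hQU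
      rw [this.fderiv_eq]
      simp
    rw [h2] at h1
    have h3 := congrArg (fun A : E →L[ℝ] E₁ => A v) h1
    simp only [zero_apply, add_apply,
      ContinuousLinearMap.comp_apply, ContinuousLinearMap.flip_apply] at h3
    exact eq_neg_of_add_eq_zero_left h3.symm
  rw [VectorField.lieBracket, map_sub, key hW hQW, key hV hQV]
  abel

end LinearFamilies

/-! ### Foliations as local kernels -/

section LocalKernels

theorem mem_span_range_equiv_iff {ι E E' : Type*} [NormedAddCommGroup E] [NormedSpace ℝ E]
    [NormedAddCommGroup E'] [NormedSpace ℝ E'] (A : E ≃L[ℝ] E') (x : ι → E) (v : E) :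
    A v ∈ Submodule.span ℝ (Set.range fun i => A (x i)) ↔ v ∈ Submodule.span ℝ (Set.range x) := by
  have e : Submodule.span ℝ (Set.range fun i => A (x i)) =
      (Submodule.span ℝ (Set.range x)).map A.toLinearEquiv.toLinearMap := by
    rw [Submodule.map_span, ← Set.range_comp]
    rfl
  rw [e]
  exact A.injective.mem_set_image (s := (Submodule.span ℝ (Set.range x) : Set E))

theorem mem_span_range_symm_iff {ι E E' : Type*} [NormedAddCommGroup E] [NormedSpace ℝ E]
    [NormedAddCommGroup E'] [NormedSpace ℝ E'] (A : E ≃L[ℝ] E') (y : ι → E') (v : E) :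
    v ∈ Submodule.span ℝ (Set.range fun i => A.symm (y i)) ↔
      A v ∈ Submodule.span ℝ (Set.range y) := by
  rw [← mem_span_range_equiv_iff A.symm y, A.symm_apply_apply]

theorem finrank_eq_of_mem_iff {E E' : Type*} [NormedAddCommGroup E] [NormedSpace ℝ E]
    [NormedAddCommGroup E'] [NormedSpace ℝ E'] (A : E ≃L[ℝ] E') (K : Submodule ℝ E)
    (K' : Submodule ℝ E') (h : ∀ v, v ∈ K ↔ A v ∈ K') :
    Module.finrank ℝ K = Module.finrank ℝ K' := by
  have e : K.map A.toLinearEquiv.toLinearMap = K' := by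
    ext v
    constructor
    · rintro ⟨u, hu, rfl⟩
      exact (h u).mp hu
    · intro hv
      exact ⟨A.symm v, (h _).mpr (by simpa using hv), A.apply_symm_apply v⟩
  rw [← e]
  exact (A.toLinearEquiv.submoduleMap K).finrank_eq

theorem map_sum_smul {ι E E' : Type*} [Fintype ι] [NormedAddCommGroup E] [NormedSpace ℝ E]
    [NormedAddCommGroup E'] [NormedSpace ℝ E'] (A : E →L[ℝ] E') (c : ι → ℝ) (x : ι → E) :
    A (∑ i, c i • x i) = ∑ i, c i • A (x i) := by
  simp

open Topology Filter VectorField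

variable {E : Type} [NormedAddCommGroup E] [NormedSpace ℝ E] [FiniteDimensional ℝ E]
  {H : Type} [TopologicalSpace H] {I : ModelWithCorners ℝ E H} [I.Boundaryless]
  {M : Type} [TopologicalSpace M] [ChartedSpace H M] [IsManifold I ∞ M]

/-- The expression of a vector field in the preferred chart at a point. -/
noncomputable def chartField (p₀ : M) (X : ∀ p : M, TangentSpace I p) : E → E :=
  mpullbackWithin 𝓘(ℝ, E) I (extChartAt I p₀).symm X (Set.range I)

set_option linter.unusedSectionVars false

theorem contDiffAt_chartField {p₀ p : M} (hp : p ∈ (extChartAt I p₀).source)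
    {X : ∀ p : M, TangentSpace I p}
    (hX : ContMDiffAt I I.tangent ∞ (fun q => (⟨q, X q⟩ : TangentBundle I M)) p) :
    ContDiffAt ℝ ∞ (chartField p₀ X) (extChartAt I p₀ p) := by
  have : CompleteSpace E := FiniteDimensional.complete ℝ E
  have hmem := (extChartAt I p₀).map_source hp
  have h := ContMDiffWithinAt.mpullbackWithin_vectorField_inter_of_eq (t := Set.univ) (s := Set.range I) (n := ∞)
    (f := (extChartAt I p₀).symm) (x₀ := extChartAt I p₀ p)
    (contMDiffWithinAt_univ.mpr hX) (contMDiffWithinAt_extChartAt_symm_range _ hmem)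
    (isInvertible_mfderivWithin_extChartAt_symm hmem) (by simp)
    (by rw [I.range_eq_univ]; exact uniqueMDiffOn_univ) le_rfl ((extChartAt I p₀).left_inv hp)
  rw [Set.preimage_univ, Set.inter_univ, I.range_eq_univ, contMDiffWithinAt_univ] at h
  unfold chartField
  rw [I.range_eq_univ]
  exact contMDiffAt_vectorSpace_iff_contDiffAt.mp h

theorem chartField_apply {p₀ p : M} (hp : p ∈ (extChartAt I p₀).source)
    (X : ∀ p : M, TangentSpace I p) :
    chartField p₀ X (extChartAt I p₀ p) = mfderiv I 𝓘(ℝ, E) (extChartAt I p₀) p (X p) := by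
  have hmem := (extChartAt I p₀).map_source hp
  have h := isInvertible_mfderivWithin_extChartAt_symm (I := I) hmem
  have h1 := mfderivWithin_extChartAt_symm_comp_mfderiv_extChartAt' (I := I) hp
  have e : (X ((extChartAt I p₀).symm (extChartAt I p₀ p)) : E) = (X p : E) :=
    congrArg (fun q => (show E from X q)) ((extChartAt I p₀).left_inv hp)
  have e1 : mfderivWithin 𝓘(ℝ, E) I (extChartAt I p₀).symm (Set.range I) (extChartAt I p₀ p)
      (mfderiv I 𝓘(ℝ, E) (extChartAt I p₀) p (X p)) = X p :=
    congrArg (fun A : E →L[ℝ] E => A (X p)) h1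
  exact h.inverse_apply_eq.mpr (e.trans e1.symm)

/-- The bracket at `p₀` is by definition transported from the preferred chart at `p₀` itself. Hence
the symmetry condition of `IsLocalKernel` is only needed at the centre of the chart. -/
theorem mfderiv_extChartAt_mlieBracket (p₀ : M) (X Y : ∀ p : M, TangentSpace I p) :
    mfderiv I 𝓘(ℝ, E) (extChartAt I p₀) p₀ (mlieBracket I X Y p₀) =
      lieBracket ℝ (chartField p₀ X) (chartField p₀ Y) (extChartAt I p₀ p₀) := by
  have h := isInvertible_mfderiv_extChartAt (I := I) (mem_extChartAt_source (I := I) p₀)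
  refine (h.self_apply_inverse _).trans ?_
  have e : (extChartAt I p₀).symm ⁻¹' Set.univ ∩ Set.range I = Set.univ := by
    rw [Set.preimage_univ, Set.univ_inter, I.range_eq_univ]
  change lieBracketWithin ℝ (chartField p₀ X) (chartField p₀ Y)
    ((extChartAt I p₀).symm ⁻¹' Set.univ ∩ Set.range I) _ = _
  rw [e, lieBracketWithin_univ]

theorem contMDiffAt_mpullback_extChartAt {p₀ p : M} (hp : p ∈ (extChartAt I p₀).source)
    {Y : E → E} (hY : ContDiffAt ℝ ∞ Y (extChartAt I p₀ p)) :
    ContMDiffAt I I.tangent ∞ (fun q => (⟨q, mpullback I 𝓘(ℝ, E) (extChartAt I p₀) Y q⟩ :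
      TangentBundle I M)) p := by
  have : CompleteSpace E := FiniteDimensional.complete ℝ E
  exact ContMDiffAt.mpullback_vectorField_preimage (n := ∞)
    (contMDiffAt_vectorSpace_iff_contDiffAt.mpr hY)
    (contMDiffAt_extChartAt' (by simpa using hp)) (isInvertible_mfderiv_extChartAt hp) le_rfl

/-- The differential at `p` of the preferred chart at `p₀`. -/
noncomputable def chartDeriv (I : ModelWithCorners ℝ E H) (p₀ p : M) : E →L[ℝ] E :=
  mfderiv I 𝓘(ℝ, E) (extChartAt I p₀) p

theorem exists_equiv_chartDeriv {p₀ p : M} (hp : p ∈ (extChartAt I p₀).source) :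
    ∃ A : E ≃L[ℝ] E, (A : E →L[ℝ] E) = chartDeriv I p₀ p :=
  isInvertible_mfderiv_extChartAt hp

/-- The absence of boundary makes the chart target a neighbourhood, so that properties near `p₀`
become properties of all nearby coordinate vectors. -/
theorem eventually_nhds_extChartAt {p₀ : M} {P : M → Prop} (hP : ∀ᶠ p in 𝓝 p₀, P p) :
    ∀ᶠ z in 𝓝 (extChartAt I p₀ p₀), ∃ p ∈ (extChartAt I p₀).source, extChartAt I p₀ p = z ∧ P p := by
  have h1 : Tendsto (extChartAt I p₀).symm (𝓝 (extChartAt I p₀ p₀)) (𝓝 p₀) := by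
    simpa [ContinuousAt] using continuousAt_extChartAt_symm (I := I) p₀
  filter_upwards [h1.eventually hP, extChartAt_target_mem_nhds (I := I) p₀] with z hz hzt
  exact ⟨_, (extChartAt I p₀).map_target hzt, (extChartAt I p₀).right_inv hzt, hz⟩

/-- Near `p₀`, the distribution `D` is, in the preferred chart at `p₀`, the kernel of the family
`Q` of linear maps, whose derivative at `p₀` is symmetric on the kernel. -/
def IsLocalKernel (D : ∀ p : M, Submodule ℝ (TangentSpace I p)) (p₀ : M)
    {E₁ : Type} [NormedAddCommGroup E₁] [NormedSpace ℝ E₁] (Q : E → E →L[ℝ] E₁) : Prop :=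
  (∀ᶠ z in 𝓝 (extChartAt I p₀ p₀), ContDiffAt ℝ ∞ Q z) ∧
  (∀ᶠ p in 𝓝 p₀, ∀ v : TangentSpace I p,
    v ∈ D p ↔ Q (extChartAt I p₀ p) (chartDeriv I p₀ p v) = 0) ∧
  ∀ v w : E, Q (extChartAt I p₀ p₀) v = 0 → Q (extChartAt I p₀ p₀) w = 0 →
    fderiv ℝ Q (extChartAt I p₀ p₀) v w = fderiv ℝ Q (extChartAt I p₀ p₀) w v

theorem IsLocalKernel.eventually_apply_chartField {D : ∀ p : M, Submodule ℝ (TangentSpace I p)}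
    {p₀ : M} {E₁ : Type} [NormedAddCommGroup E₁] [NormedSpace ℝ E₁] {Q : E → E →L[ℝ] E₁}
    (hQ : ∀ᶠ p in 𝓝 p₀, ∀ v : TangentSpace I p,
      v ∈ D p ↔ Q (extChartAt I p₀ p) (chartDeriv I p₀ p v) = 0)
    {X : ∀ p : M, TangentSpace I p} (hX : ∀ᶠ p in 𝓝 p₀, X p ∈ D p) :
    ∀ᶠ z in 𝓝 (extChartAt I p₀ p₀), Q z (chartField p₀ X z) = 0 := by
  filter_upwards [eventually_nhds_extChartAt (I := I) (hQ.and hX)]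
  rintro _ ⟨p, hp, rfl, hpQ, hpX⟩
  rw [chartField_apply hp]
  exact (hpQ _).mp hpX

/-- The Lie bracket of two sections of a distribution given by a local kernel. -/
theorem apply_chartDeriv_mlieBracket {D : ∀ p : M, Submodule ℝ (TangentSpace I p)}
    {p₀ : M} {E₁ : Type} [NormedAddCommGroup E₁] [NormedSpace ℝ E₁] {Q : E → E →L[ℝ] E₁}
    (hQs : ContDiffAt ℝ ∞ Q (extChartAt I p₀ p₀))
    (hQ : ∀ᶠ p in 𝓝 p₀, ∀ v : TangentSpace I p,
      v ∈ D p ↔ Q (extChartAt I p₀ p) (chartDeriv I p₀ p v) = 0)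
    {U : Set M} (hU : U ∈ 𝓝 p₀) {X Y : ∀ p : M, TangentSpace I p}
    (hX : ContMDiffOn I I.tangent ∞ (fun q => (⟨q, X q⟩ : TangentBundle I M)) U)
    (hY : ContMDiffOn I I.tangent ∞ (fun q => (⟨q, Y q⟩ : TangentBundle I M)) U)
    (hXD : ∀ q ∈ U, X q ∈ D q) (hYD : ∀ q ∈ U, Y q ∈ D q) :
    Q (extChartAt I p₀ p₀) (chartDeriv I p₀ p₀ (mlieBracket I X Y p₀)) =
      fderiv ℝ Q (extChartAt I p₀ p₀) (chartDeriv I p₀ p₀ (Y p₀)) (chartDeriv I p₀ p₀ (X p₀)) -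
      fderiv ℝ Q (extChartAt I p₀ p₀) (chartDeriv I p₀ p₀ (X p₀)) (chartDeriv I p₀ p₀ (Y p₀)) := by
  have hsrc := mem_extChartAt_source (I := I) p₀
  have h1 := apply_lieBracket_of_apply_eq_zero (V := chartField p₀ X) (W := chartField p₀ Y)
    (hQs.differentiableAt (by simp))
    ((contDiffAt_chartField hsrc (hX.contMDiffAt hU)).differentiableAt (by simp))
    ((contDiffAt_chartField hsrc (hY.contMDiffAt hU)).differentiableAt (by simp))
    (IsLocalKernel.eventually_apply_chartField hQ (eventually_of_mem hU hXD))
    (IsLocalKernel.eventually_apply_chartField hQ (eventually_of_mem hU hYD))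
  rw [← mfderiv_extChartAt_mlieBracket, chartField_apply hsrc, chartField_apply hsrc] at h1
  exact h1

/-- A foliation is locally a kernel. -/
theorem Foliation.exists_isLocalKernel (F : Foliation I M) (p₀ : M) :
    ∃ P : E → E →L[ℝ] E, IsLocalKernel F.D p₀ P := by
  obtain ⟨U, hUo, hpU, X, hX, hXD⟩ := F.exists_frame p₀
  have hU := hUo.mem_nhds hpU
  have hsrc := mem_extChartAt_source (I := I) p₀
  have hfield : ∀ p ∈ (extChartAt I p₀).source, ∀ i,
      chartField p₀ (X i) (extChartAt I p₀ p) = chartDeriv I p₀ p (X i p) :=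
    fun p hp i => chartField_apply hp (X i)
  have hsm : ∀ᶠ z in 𝓝 (extChartAt I p₀ p₀), ∀ i, ContDiffAt ℝ ∞ (chartField p₀ (X i)) z := by
    filter_upwards [eventually_nhds_extChartAt (I := I) (hUo.mem_nhds hpU)]
    rintro _ ⟨p, hp, rfl, hpU'⟩ i
    exact contDiffAt_chartField hp ((hX i).contMDiffAt (hUo.mem_nhds hpU'))
  have hli : LinearIndependent ℝ fun i => chartField p₀ (X i) (extChartAt I p₀ p₀) := by
    obtain ⟨A, hA⟩ := exists_equiv_chartDeriv hsrc
    simp only [hfield p₀ hsrc, ← hA]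
    exact (hXD p₀ hpU).1.map' A.toLinearEquiv.toLinearMap A.toLinearEquiv.ker
  obtain ⟨P, hP, hPX⟩ := exists_ker_eq_span hsm hli
  have hker : ∀ᶠ p in 𝓝 p₀, ∀ v : TangentSpace I p,
      v ∈ F.D p ↔ P (extChartAt I p₀ p) (chartDeriv I p₀ p v) = 0 := by
    filter_upwards [(continuousAt_extChartAt (I := I) p₀).eventually hPX,
      extChartAt_source_mem_nhds (I := I) p₀, hU] with p hp hps hpU' v
    obtain ⟨A, hA⟩ := exists_equiv_chartDeriv hps
    rw [hp, ← (hXD p hpU').2]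
    simp only [hfield p hps, ← hA]
    exact (mem_span_range_equiv_iff A (fun i => X i p) v).symm
  refine ⟨P, hP, hker, fun v w hv hw => ?_⟩
  -- A kernel vector extends to a section with constant coefficients in the frame. Involutivity puts
  -- the bracket of two such sections in the kernel, and the bracket formula turns this into the
  -- symmetry of `dP`.
  have hext : ∀ v : E, P (extChartAt I p₀ p₀) v = 0 → ∃ V : ∀ p : M, TangentSpace I p,
      ContMDiffOn I I.tangent ∞ (fun q => (⟨q, V q⟩ : TangentBundle I M)) U ∧
      (∀ q ∈ U, V q ∈ F.D q) ∧ chartDeriv I p₀ p₀ (V p₀) = v := by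
    intro v hv
    rw [hPX.self_of_nhds, Submodule.mem_span_range_iff_exists_fun] at hv
    obtain ⟨c, hc⟩ := hv
    refine ⟨fun p => ∑ i, c i • X i p, ?_, ?_, ?_⟩
    · exact ContMDiffOn.sum_section fun i _ => (hX i).const_smul_section
    · intro q hq
      rw [← (hXD q hq).2]
      exact Submodule.sum_mem _ fun i _ =>
        Submodule.smul_mem _ _ (Submodule.subset_span (Set.mem_range_self i))
    · rw [← hc]
      simp only [hfield p₀ hsrc]
      exact map_sum_smul (chartDeriv I p₀ p₀) c fun i => X i p₀
  obtain ⟨V, hV, hVD, rfl⟩ := hext v hv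
  obtain ⟨W, hW, hWD, rfl⟩ := hext w hw
  have h1 := apply_chartDeriv_mlieBracket hP.self_of_nhds hker hU hV hW hVD hWD
  rw [(hker.self_of_nhds _).mp (F.involutive U hUo V W hV hW hVD hWD p₀ hpU)] at h1
  exact (sub_eq_zero.mp h1.symm).symm

/-- A distribution of constant rank which is locally a kernel is a foliation. -/
def Foliation.ofLocalKernel (D : ∀ p : M, Submodule ℝ (TangentSpace I p)) (r : ℕ)
    (hr : ∀ p, Module.finrank ℝ (D p) = r)
    {E₁ : Type} [NormedAddCommGroup E₁] [NormedSpace ℝ E₁] [FiniteDimensional ℝ E₁]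
    (hD : ∀ p₀ : M, ∃ Q : E → E →L[ℝ] E₁, IsLocalKernel D p₀ Q) : Foliation I M where
  rank := r
  D := D
  exists_frame p₀ := by
    obtain ⟨Q, hQ, hker, -⟩ := hD p₀
    have hfin : ∀ᶠ z in 𝓝 (extChartAt I p₀ p₀),
        Module.finrank ℝ (LinearMap.ker (Q z).toLinearMap) = r := by
      filter_upwards [eventually_nhds_extChartAt (I := I) hker]
      rintro _ ⟨p, hp, rfl, hpQ⟩
      obtain ⟨A, hA⟩ := exists_equiv_chartDeriv hp
      rw [← hr p]
      refine (finrank_eq_of_mem_iff A (D p) _ fun v => ?_).symm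
      rw [← hA] at hpQ
      exact hpQ v
    obtain ⟨Y, hY, hYQ⟩ := exists_frame_of_finrank_ker hQ hfin
    have hev := (continuousAt_extChartAt (I := I) p₀).eventually (hY.and hYQ)
    obtain ⟨U, hU, hUo, hpU⟩ := eventually_nhds_iff.mp
      (Filter.Eventually.and (extChartAt_source_mem_nhds (I := I) p₀) (hev.and hker))
    refine ⟨U, hUo, hpU, fun i => mpullback I 𝓘(ℝ, E) (extChartAt I p₀) (Y i), ?_, ?_⟩
    · intro i q hq
      obtain ⟨hqs, ⟨hqY, -⟩, -⟩ := hU q hq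
      exact (contMDiffAt_mpullback_extChartAt hqs (hqY i)).contMDiffWithinAt
    · intro q hq
      obtain ⟨hqs, ⟨-, hli, hspan⟩, hqk⟩ := hU q hq
      obtain ⟨A, hA⟩ := exists_equiv_chartDeriv hqs
      have hX : ∀ i, mpullback I 𝓘(ℝ, E) (extChartAt I p₀) (Y i) q =
          A.symm (Y i (extChartAt I p₀ q)) := by
        intro i
        have h1 : mpullback I 𝓘(ℝ, E) (extChartAt I p₀) (Y i) q =
          (chartDeriv I p₀ q).inverse (Y i (extChartAt I p₀ q)) := rfl
        rw [h1, ← hA, ContinuousLinearMap.inverse_equiv]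
        rfl
      simp only [hX]
      constructor
      · exact hli.map' A.symm.toLinearEquiv.toLinearMap A.symm.toLinearEquiv.ker
      · refine Submodule.ext fun v => ?_
        rw [hqk v, ← hA]
        have h1 := mem_span_range_symm_iff A (fun i => Y i (extChartAt I p₀ q)) v
        rw [hspan] at h1
        exact h1
  involutive U hU X Y hX hY hXD hYD q hq := by
    obtain ⟨Q, hQ, hker, hsymm⟩ := hD q
    have hkq := hker.self_of_nhds
    -- `Q` applied to the bracket is the antisymmetrization of `dQ` on two kernel vectors, which
    -- vanishes by hypothesis.
    rw [hkq, apply_chartDeriv_mlieBracket hQ.self_of_nhds hker (hU.mem_nhds hq) hX hY hXD hYD,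
      sub_eq_zero]
    exact hsymm _ _ ((hkq _).mp (hYD q hq)) ((hkq _).mp (hXD q hq))

end LocalKernels

/-! ### Pullbacks and intersections of foliations -/

section PullbackFoliation

open Topology Filter VectorField

set_option linter.unusedSectionVars false

variable {E : Type} [NormedAddCommGroup E] [NormedSpace ℝ E] [FiniteDimensional ℝ E]
  {H : Type} [TopologicalSpace H] {I : ModelWithCorners ℝ E H} [I.Boundaryless]
  {M : Type} [TopologicalSpace M] [ChartedSpace H M] [IsManifold I ∞ M]
  {E' : Type} [NormedAddCommGroup E'] [NormedSpace ℝ E'] [FiniteDimensional ℝ E']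
  {H' : Type} [TopologicalSpace H'] {I' : ModelWithCorners ℝ E' H'} [I'.Boundaryless]
  {M' : Type} [TopologicalSpace M'] [ChartedSpace H' M'] [IsManifold I' ∞ M']
  {E'' : Type} [NormedAddCommGroup E''] [NormedSpace ℝ E''] [FiniteDimensional ℝ E'']
  {H'' : Type} [TopologicalSpace H''] {I'' : ModelWithCorners ℝ E'' H''} [I''.Boundaryless]
  {M'' : Type} [TopologicalSpace M''] [ChartedSpace H'' M''] [IsManifold I'' ∞ M'']

/-- The derivative formula holds at all nearby points, not only at `t₀`, with the charts kept fixed: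
a family of maps describing a distribution near `f t₀` can therefore be composed with `g` and its
derivative. -/
theorem exists_chart_expression {f : M → M'} (hf : ContMDiff I I' ∞ f) (t₀ : M) :
    ∃ g : E → E', (∀ᶠ z in 𝓝 (extChartAt I t₀ t₀), ContDiffAt ℝ ∞ g z) ∧
      ∀ᶠ t in 𝓝 t₀, g (extChartAt I t₀ t) = extChartAt I' (f t₀) (f t) ∧
        ∀ v : E, fderiv ℝ g (extChartAt I t₀ t) (chartDeriv I t₀ t v) =
          chartDeriv I' (f t₀) (f t) (mfderiv I I' f t v) := by
  have hsrc : ∀ᶠ t in 𝓝 t₀, t ∈ (extChartAt I t₀).source ∧ f t ∈ (extChartAt I' (f t₀)).source :=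
    Filter.Eventually.and (extChartAt_source_mem_nhds (I := I) t₀)
      (hf.continuous.continuousAt.eventually (extChartAt_source_mem_nhds (I := I') (f t₀)))
  have hsm : ∀ t, t ∈ (extChartAt I t₀).source → f t ∈ (extChartAt I' (f t₀)).source →
      ContDiffAt ℝ ∞ (fun z => extChartAt I' (f t₀) (f ((extChartAt I t₀).symm z)))
        (extChartAt I t₀ t) := by
    intro t ht hft
    rw [← contMDiffAt_iff_contDiffAt]
    have h1 : ContMDiffAt 𝓘(ℝ, E) I ∞ (extChartAt I t₀).symm (extChartAt I t₀ t) := by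
      have := contMDiffWithinAt_extChartAt_symm_range (I := I) (n := ∞) t₀
        ((extChartAt I t₀).map_source ht)
      rwa [I.range_eq_univ, contMDiffWithinAt_univ] at this
    have e := (extChartAt I t₀).left_inv ht
    have h2 : ContMDiffAt I' 𝓘(ℝ, E') ∞ (extChartAt I' (f t₀)) (f t) :=
      contMDiffAt_extChartAt' (by simpa using hft)
    exact ContMDiffAt.comp_of_eq h2 ((hf.contMDiffAt (x := t)).comp_of_eq h1 e) (by simp only [e])
  refine ⟨fun z => extChartAt I' (f t₀) (f ((extChartAt I t₀).symm z)), ?_, ?_⟩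
  · filter_upwards [eventually_nhds_extChartAt (I := I) hsrc]
    rintro _ ⟨t, ht, rfl, -, hft⟩
    exact hsm t ht hft
  · filter_upwards [hsrc, eventually_eventually_nhds.mpr hsrc] with t ht ht'
    have e := (extChartAt I t₀).left_inv ht.1
    refine ⟨by simp only [e], fun v => ?_⟩
    have h1 : MDifferentiableAt 𝓘(ℝ, E) 𝓘(ℝ, E')
        (fun z => extChartAt I' (f t₀) (f ((extChartAt I t₀).symm z))) (extChartAt I t₀ t) :=
      mdifferentiableAt_iff_differentiableAt.mpr ((hsm t ht.1 ht.2).differentiableAt (by simp))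
    have h2 : MDifferentiableAt I 𝓘(ℝ, E) (extChartAt I t₀) t :=
      mdifferentiableAt_extChartAt (by simpa using ht.1)
    have h3 : MDifferentiableAt I' 𝓘(ℝ, E') (extChartAt I' (f t₀)) (f t) :=
      mdifferentiableAt_extChartAt (by simpa using ht.2)
    have h4 : MDifferentiableAt I I' f t := (hf.contMDiffAt (x := t)).mdifferentiableAt (by simp)
    have h5 := mfderiv_comp t h1 h2
    have h6 := mfderiv_comp t h3 h4
    have h7 : (fun z => extChartAt I' (f t₀) (f ((extChartAt I t₀).symm z))) ∘ extChartAt I t₀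
        =ᶠ[𝓝 t] extChartAt I' (f t₀) ∘ f := by
      filter_upwards [ht'] with s hs
      simp only [Function.comp_apply, (extChartAt I t₀).left_inv hs.1]
    rw [h7.mfderiv_eq, mfderiv_eq_fderiv] at h5
    exact congrArg (fun A : E →L[ℝ] E' => A v) (h5.symm.trans h6)

/-- The preimage of a foliation by a smooth map, as a family of subspaces. -/
noncomputable def pullbackDist (f : M → M') (F : Foliation I' M') (t : M) :
    Submodule ℝ (TangentSpace I t) :=
  (F.D (f t)).comap (mfderiv I I' f t).toLinearMap

/-- The pullback is the kernel of `P(g) ∘ dg`, whose derivative is `dP(dg v)(dg w) + P(d²g(v, w))`.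
The first term is symmetric on the kernel because `F` is involutive, the second because second
derivatives are symmetric; no vector field has to be lifted. -/
theorem IsLocalKernel.pullback {f : M → M'} (hf : ContMDiff I I' ∞ f) (F : Foliation I' M')
    (t₀ : M) : ∃ Q : E → E →L[ℝ] E', IsLocalKernel (pullbackDist (I := I) f F) t₀ Q := by
  obtain ⟨P, hP, hker, hsymm⟩ := F.exists_isLocalKernel (f t₀)
  obtain ⟨g, hg, hgt⟩ := exists_chart_expression hf t₀
  have hg₀ : g (extChartAt I t₀ t₀) = extChartAt I' (f t₀) (f t₀) := hgt.self_of_nhds.1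
  have hgs := hg.self_of_nhds
  have hPg : ∀ᶠ z in 𝓝 (extChartAt I t₀ t₀), ContDiffAt ℝ ∞ P (g z) := by
    apply hgs.continuousAt.eventually
    rw [hg₀]
    exact hP
  refine ⟨fun z => (P (g z)).comp (fderiv ℝ g z), ?_, ?_, ?_⟩
  · filter_upwards [hg, hPg] with z hz hPz
    exact (hPz.comp z hz).clm_comp (hz.fderiv_right (by simp))
  · filter_upwards [hgt, hf.continuous.continuousAt.eventually hker] with t ht hkt v
    refine (hkt (mfderiv I I' f t v)).trans (Eq.congr ?_ rfl)
    exact congrArg₂ (fun (A : E' →L[ℝ] E') (u : E') => A u) (congrArg P ht.1.symm) (ht.2 v).symm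
  · intro v w hv hw
    have hPd : HasFDerivAt (fun z => P (g z)) _ (extChartAt I t₀ t₀) :=
      HasFDerivAt.comp _ (hPg.self_of_nhds.differentiableAt (by simp)).hasFDerivAt
        (hgs.differentiableAt (by simp)).hasFDerivAt
    have hgd : HasFDerivAt (fderiv ℝ g) _ (extChartAt I t₀ t₀) :=
      ((hgs.fderiv_right (m := ∞) (by simp)).differentiableAt (by simp)).hasFDerivAt
    rw [(hPd.clm_comp hgd).fderiv]
    have hs : IsSymmSndFDerivAt ℝ g (extChartAt I t₀ t₀) :=
      hgs.isSymmSndFDerivAt (by simpa using WithTop.coe_le_coe.mpr (le_top : (2 : ℕ∞) ≤ ⊤))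
    have h1 := hsymm (fderiv ℝ g (extChartAt I t₀ t₀) v) (fderiv ℝ g (extChartAt I t₀ t₀) w)
      (by rw [← hg₀]; exact hv) (by rw [← hg₀]; exact hw)
    rw [← hg₀] at h1
    simp only [add_apply, ContinuousLinearMap.comp_apply, ContinuousLinearMap.compL_apply,
      ContinuousLinearMap.flip_apply]
    rw [h1, hs.eq v w]

theorem IsLocalKernel.inf {D D' : ∀ p : M, Submodule ℝ (TangentSpace I p)} {t₀ : M}
    {E₁ E₂ : Type} [NormedAddCommGroup E₁] [NormedSpace ℝ E₁] [NormedAddCommGroup E₂]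
    [NormedSpace ℝ E₂] {Q : E → E →L[ℝ] E₁} {Q' : E → E →L[ℝ] E₂}
    (h : IsLocalKernel D t₀ Q) (h' : IsLocalKernel D' t₀ Q') :
    IsLocalKernel (fun t => D t ⊓ D' t) t₀ (fun z => (Q z).prod (Q' z)) := by
  obtain ⟨hQ, hker, hsymm⟩ := h
  obtain ⟨hQ', hker', hsymm'⟩ := h'
  refine ⟨?_, ?_, ?_⟩
  · filter_upwards [hQ, hQ'] with z hz hz'
    exact (ContinuousLinearMap.prodL ℝ (𝕜 := ℝ) (E := E) (F := E₁) (G := E₂)).contDiff.contDiffAt.comp z (hz.prodMk hz')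
  · filter_upwards [hker, hker'] with t ht ht' v
    rw [Submodule.mem_inf, ht v, ht' v]
    exact Prod.mk_eq_zero.symm
  · intro v w hv hw
    have hd : HasFDerivAt (fun z => (Q z).prod (Q' z)) _ (extChartAt I t₀ t₀) :=
      (ContinuousLinearMap.prodL ℝ (𝕜 := ℝ) (E := E) (F := E₁) (G := E₂)).hasFDerivAt.comp _
        ((hQ.self_of_nhds.differentiableAt (by simp)).hasFDerivAt.prodMk
          (hQ'.self_of_nhds.differentiableAt (by simp)).hasFDerivAt)
    rw [hd.fderiv]
    obtain ⟨hv1, hv2⟩ := Prod.mk_eq_zero.mp hv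
    obtain ⟨hw1, hw2⟩ := Prod.mk_eq_zero.mp hw
    exact Prod.ext (hsymm v w hv1 hw1) (hsymm' v w hv2 hw2)

/-- The intersection of the preimages of two foliations by smooth maps, if its rank is constant. -/
noncomputable def Foliation.pullback₂ {f : M → M'} (hf : ContMDiff I I' ∞ f)
    {g : M → M''} (hg : ContMDiff I I'' ∞ g)
    (F : Foliation I' M') (F' : Foliation I'' M'') (r : ℕ)
    (hr : ∀ t : M, Module.finrank ℝ
      ((pullbackDist f F t ⊓ pullbackDist g F' t : Submodule ℝ (TangentSpace I t))) = r) :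
    Foliation I M :=
  Foliation.ofLocalKernel (E₁ := E' × E'')
    (fun t => pullbackDist f F t ⊓ pullbackDist g F' t) r hr (fun t₀ => by
    obtain ⟨Q, hQ⟩ := IsLocalKernel.pullback hf F t₀
    obtain ⟨Q', hQ'⟩ := IsLocalKernel.pullback hg F' t₀
    exact ⟨_, hQ.inf hQ'⟩)

end PullbackFoliation

/-! ### Products of foliated manifolds -/

section Objects

theorem Foliation.finrank_eq {E : Type} [NormedAddCommGroup E] [NormedSpace ℝ E] {H : Type}
    [TopologicalSpace H] {I : ModelWithCorners ℝ E H} {M : Type} [TopologicalSpace M]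
    [ChartedSpace H M] [IsManifold I ∞ M] (F : Foliation I M) (p : M) :
    Module.finrank ℝ (F.D p) = F.rank := by
  obtain ⟨U, -, hp, X, -, hX⟩ := F.exists_frame p
  rw [← (hX p hp).2, finrank_span_eq_card (hX p hp).1, Fintype.card_fin]

/-- The foliation of rank zero. -/
noncomputable def Foliation.discrete {E : Type} [NormedAddCommGroup E] [NormedSpace ℝ E]
    [FiniteDimensional ℝ E] {H : Type} [TopologicalSpace H] (I : ModelWithCorners ℝ E H)
    [I.Boundaryless] (M : Type) [TopologicalSpace M] [ChartedSpace H M] [IsManifold I ∞ M] :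
    Foliation I M :=
  Foliation.ofLocalKernel (E₁ := E) (fun _ => ⊥) 0 (fun _ => finrank_bot _ _) fun p₀ => by
    refine ⟨fun _ => ContinuousLinearMap.id ℝ E, Filter.Eventually.of_forall fun z =>
      contDiffAt_const, ?_, fun v w _ _ => by simp⟩
    filter_upwards [extChartAt_source_mem_nhds (I := I) p₀] with p hp v
    obtain ⟨A, hA⟩ := exists_equiv_chartDeriv hp
    rw [← hA]
    exact (map_eq_zero_iff A A.injective).symm

theorem finrank_submodule_prod {E E' : Type*} [NormedAddCommGroup E] [NormedSpace ℝ E]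
    [FiniteDimensional ℝ E] [NormedAddCommGroup E'] [NormedSpace ℝ E'] [FiniteDimensional ℝ E']
    (K : Submodule ℝ E) (K' : Submodule ℝ E') :
    Module.finrank ℝ (K.comap (ContinuousLinearMap.fst ℝ E E').toLinearMap ⊓
      K'.comap (ContinuousLinearMap.snd ℝ E E').toLinearMap : Submodule ℝ (E × E')) =
      Module.finrank ℝ K + Module.finrank ℝ K' := by
  rw [← Module.finrank_prod]
  exact LinearEquiv.finrank_eq
    { toFun := fun x => (⟨x.1.1, x.2.1⟩, ⟨x.1.2, x.2.2⟩)
      invFun := fun y => ⟨(y.1.1, y.2.1), y.1.2, y.2.2⟩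
      map_add' := fun _ _ => rfl
      map_smul' := fun _ _ => rfl
      left_inv := fun _ => rfl
      right_inv := fun _ => rfl }

namespace FMn

theorem diff_comp_apply {M N P : FMn} {g : N → P} {f : M → N} (hg : ContMDiff N.I P.I ∞ g)
    (hf : ContMDiff M.I N.I ∞ f) (p : M) (v : TangentSpace M.I p) :
    diff (g ∘ f) p v = diff g (f p) (diff f p v) := by
  rw [diff_comp hg hf]
  rfl

theorem D_eq_bot {X : FMn} (hX : X.fol.rank = 0) (p : X) : X.fol.D p = ⊥ := by
  have : FiniteDimensional ℝ (TangentSpace X.I p) := inferInstanceAs (FiniteDimensional ℝ X.E)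
  rw [← Submodule.finrank_eq_zero, X.fol.finrank_eq, hX]

theorem diff_const {M N : FMn} (c : N) (p : M) : diff (fun _ : M => c) p = 0 := by
  unfold diff
  rw [mfderiv_const]
  rfl

theorem comp_fn {M N P : FMn} (f : M ⟶ N) (g : N ⟶ P) (x : M) : fn (f ≫ g) x = fn g (fn f x) := rfl

theorem hom_ext {M N : FMn} {f g : M ⟶ N} (h : ∀ x, fn f x = fn g x) : f = g :=
  Hom.ext (funext h)

theorem contMDiff_fn {M N : FMn} (f : M ⟶ N) : ContMDiff M.I N.I ∞ (fn f) := Hom.contMDiff f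

theorem map_fol_fn {M N : FMn} (f : M ⟶ N) (p : M) :
    (M.fol.D p).map (diff (fn f) p) = N.fol.D (fn f p) := Hom.map_fol f p

theorem diff_fn_mem {M N : FMn} (f : M ⟶ N) {p : M} {v : TangentSpace M.I p}
    (hv : v ∈ M.fol.D p) : diff (fn f) p v ∈ N.fol.D (fn f p) := by
  rw [← map_fol_fn]
  exact Submodule.mem_map_of_mem hv

theorem exists_diff_fn_eq {M N : FMn} (f : M ⟶ N) {p : M} {w : TangentSpace N.I (fn f p)}
    (hw : w ∈ N.fol.D (fn f p)) : ∃ v ∈ M.fol.D p, diff (fn f) p v = w := by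
  rw [← map_fol_fn] at hw
  exact hw

/-- A morphism from its underlying map. -/
def mkHom {M N : FMn} (f : M → N) (hf : ContMDiff M.I N.I ∞ f)
    (h₁ : ∀ p, ∀ v ∈ M.fol.D p, diff f p v ∈ N.fol.D (f p))
    (h₂ : ∀ p, ∀ w ∈ N.fol.D (f p), ∃ v ∈ M.fol.D p, diff f p v = w) : M ⟶ N :=
  (⟨f, hf, fun p => le_antisymm (by rintro _ ⟨v, hv, rfl⟩; exact h₁ p v hv) fun w hw => h₂ p w hw⟩ :
    Hom M N)

/-- A smooth map to a manifold with the foliation of rank zero. -/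
def mkHomDiscrete {M N : FMn} (hN : N.fol.rank = 0) (f : M → N) (hf : ContMDiff M.I N.I ∞ f)
    (h : ∀ p, ∀ v ∈ M.fol.D p, diff f p v = 0) : M ⟶ N :=
  mkHom f hf (fun p v hv => by rw [h p v hv]; exact Submodule.zero_mem _) (fun p w hw => by
    rw [D_eq_bot hN, Submodule.mem_bot] at hw
    exact ⟨0, Submodule.zero_mem _, by rw [hw, map_zero]⟩)

theorem diff_fn_eq_zero {M N : FMn} (hN : N.fol.rank = 0) (f : M ⟶ N) {p : M}
    {v : TangentSpace M.I p} (hv : v ∈ M.fol.D p) : diff (fn f) p v = 0 := by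
  have := diff_fn_mem f hv
  rwa [D_eq_bot hN, Submodule.mem_bot] at this

theorem finrank_prodDist (X Y : FMn) (p : X × Y) :
    Module.finrank ℝ ((pullbackDist (I := X.I.prod Y.I) (Prod.fst : X × Y → X) X.fol p ⊓
      pullbackDist (I := X.I.prod Y.I) (Prod.snd : X × Y → Y) Y.fol p :
        Submodule ℝ (TangentSpace (X.I.prod Y.I) p))) = X.fol.rank + Y.fol.rank := by
  rw [← X.fol.finrank_eq p.1, ← Y.fol.finrank_eq p.2]
  have h₁ : mfderiv (X.I.prod Y.I) X.I (Prod.fst : X × Y → X) p =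
    ContinuousLinearMap.fst ℝ X.E Y.E := mfderiv_fst
  have h₂ : mfderiv (X.I.prod Y.I) Y.I (Prod.snd : X × Y → Y) p =
    ContinuousLinearMap.snd ℝ X.E Y.E := mfderiv_snd
  unfold pullbackDist
  rw [h₁, h₂]
  exact finrank_submodule_prod (E := X.E) (E' := Y.E) (X.fol.D p.1) (Y.fol.D p.2)

/-- The product manifold with the product foliation. -/
noncomputable def prodObj (X Y : FMn) : FMn where
  E := X.E × Y.E
  H := ModelProd X.H Y.H
  I := X.I.prod Y.I
  carrier := X × Y
  fol := Foliation.pullback₂ contMDiff_fst contMDiff_snd X.fol Y.fol _ (finrank_prodDist X Y)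

def pfst {X Y : FMn} (p : prodObj X Y) : X := (show X × Y from p).1

def psnd {X Y : FMn} (p : prodObj X Y) : Y := (show X × Y from p).2

def pmk {X Y : FMn} (x : X) (y : Y) : prodObj X Y := (show X × Y from (x, y))

theorem mem_prodObj_D {X Y : FMn} {p : prodObj X Y} {v : TangentSpace (prodObj X Y).I p} :
    v ∈ (prodObj X Y).fol.D p ↔ diff pfst p v ∈ X.fol.D (pfst p) ∧
      diff psnd p v ∈ Y.fol.D (psnd p) := Iff.rfl

theorem exists_diff_fst_snd {X Y : FMn} (p : prodObj X Y) (u : TangentSpace X.I (pfst p))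
    (w : TangentSpace Y.I (psnd p)) : ∃ v : TangentSpace (prodObj X Y).I p,
      diff pfst p v = u ∧
      diff psnd p v = w := by
  refine ⟨(u, w), ?_, ?_⟩
  · exact congrArg (fun A : X.E × Y.E →L[ℝ] X.E => A (u, w)) mfderiv_fst
  · exact congrArg (fun A : X.E × Y.E →L[ℝ] Y.E => A (u, w)) mfderiv_snd

theorem prodObj_tangent_ext {X Y : FMn} {p : prodObj X Y} {v w : TangentSpace (prodObj X Y).I p}
    (h₁ : diff pfst p v =
      diff pfst p w)
    (h₂ : diff psnd p v =
      diff psnd p w) : v = w := by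
  have e₁ : ∀ v : TangentSpace (prodObj X Y).I p,
      diff pfst p v = (show X.E × Y.E from v).1 := fun v =>
    congrArg (fun A : X.E × Y.E →L[ℝ] X.E => A v) mfderiv_fst
  have e₂ : ∀ v : TangentSpace (prodObj X Y).I p,
      diff psnd p v = (show X.E × Y.E from v).2 := fun v =>
    congrArg (fun A : X.E × Y.E →L[ℝ] Y.E => A v) mfderiv_snd
  exact Prod.ext ((e₁ v).symm.trans (h₁.trans (e₁ w))) ((e₂ v).symm.trans (h₂.trans (e₂ w)))

theorem contMDiff_prodObj_fst (X Y : FMn) :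
    ContMDiff (prodObj X Y).I X.I ∞ (pfst : prodObj X Y → X) :=
  (contMDiff_fst : ContMDiff (X.I.prod Y.I) X.I ∞ (Prod.fst : X × Y → X))

theorem contMDiff_prodObj_snd (X Y : FMn) :
    ContMDiff (prodObj X Y).I Y.I ∞ (psnd : prodObj X Y → Y) :=
  (contMDiff_snd : ContMDiff (X.I.prod Y.I) Y.I ∞ (Prod.snd : X × Y → Y))

theorem contMDiff_prodObj_mk {T X Y : FMn} {f : T → X} {g : T → Y} (hf : ContMDiff T.I X.I ∞ f)
    (hg : ContMDiff T.I Y.I ∞ g) :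
    ContMDiff T.I (prodObj X Y).I ∞ (fun t => pmk (f t) (g t)) :=
  (hf.prodMk hg : ContMDiff T.I (X.I.prod Y.I) ∞ fun t => (f t, g t))

theorem diff_fst_mk {T X Y : FMn} {f : T → X} {g : T → Y} (hf : ContMDiff T.I X.I ∞ f)
    (hg : ContMDiff T.I Y.I ∞ g) (t : T) (v : TangentSpace T.I t) :
    diff pfst (pmk (f t) (g t))
      (diff (fun t => pmk (f t) (g t)) t v) = diff f t v :=
  (diff_comp_apply (contMDiff_prodObj_fst X Y) (contMDiff_prodObj_mk hf hg) t v).symm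

theorem diff_snd_mk {T X Y : FMn} {f : T → X} {g : T → Y} (hf : ContMDiff T.I X.I ∞ f)
    (hg : ContMDiff T.I Y.I ∞ g) (t : T) (v : TangentSpace T.I t) :
    diff psnd (pmk (f t) (g t))
      (diff (fun t => pmk (f t) (g t)) t v) = diff g t v :=
  (diff_comp_apply (contMDiff_prodObj_snd X Y) (contMDiff_prodObj_mk hf hg) t v).symm

/-- The projections of a product whose first factor has rank zero, and its universal property. -/
noncomputable def prodFst {X : FMn} (hX : X.fol.rank = 0) (Y : FMn) : prodObj X Y ⟶ X :=
  mkHomDiscrete hX pfst (contMDiff_prodObj_fst X Y) fun p v hv => by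
    have := (mem_prodObj_D.mp hv).1
    rwa [D_eq_bot hX, Submodule.mem_bot] at this

noncomputable def prodSnd (X Y : FMn) : prodObj X Y ⟶ Y :=
  mkHom psnd (contMDiff_prodObj_snd X Y) (fun p v hv => (mem_prodObj_D.mp hv).2)
    (fun p w hw => by
      obtain ⟨v, hv₁, hv₂⟩ := exists_diff_fst_snd p 0 w
      exact ⟨v, mem_prodObj_D.mpr ⟨by rw [hv₁]; exact Submodule.zero_mem _, by rwa [hv₂]⟩, hv₂⟩)

/-- Rank zero of `X` is what makes the lift a morphism: the image of the foliation of `T` must be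
the whole product foliation, whereas for two factors of positive rank it may be only a part of it,
such as a diagonal. -/
noncomputable def prodLift {X : FMn} (hX : X.fol.rank = 0) {T Y : FMn} (f : T ⟶ X) (g : T ⟶ Y) :
    T ⟶ prodObj X Y :=
  mkHom (fun t => pmk (fn f t) (fn g t)) (contMDiff_prodObj_mk (contMDiff_fn f) (contMDiff_fn g))
    (fun t v hv => mem_prodObj_D.mpr
      ⟨by rw [diff_fst_mk (contMDiff_fn f) (contMDiff_fn g)]; exact diff_fn_mem f hv,
        by rw [diff_snd_mk (contMDiff_fn f) (contMDiff_fn g)]; exact diff_fn_mem g hv⟩)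
    (fun t w hw => by
      obtain ⟨hw₁, hw₂⟩ := mem_prodObj_D.mp hw
      obtain ⟨v, hv, hvw⟩ := exists_diff_fn_eq g hw₂
      refine ⟨v, hv, prodObj_tangent_ext ?_ ?_⟩
      · rw [diff_fst_mk (contMDiff_fn f) (contMDiff_fn g), diff_fn_eq_zero hX f hv]
        rw [D_eq_bot hX, Submodule.mem_bot] at hw₁
        exact hw₁.symm
      · rw [diff_snd_mk (contMDiff_fn f) (contMDiff_fn g), hvw])

noncomputable def prodIsLimit {X : FMn} (hX : X.fol.rank = 0) (Y : FMn) :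
    IsLimit (BinaryFan.mk (prodFst hX Y) (prodSnd X Y)) :=
  BinaryFan.IsLimit.mk _ (fun f g => prodLift hX f g) (fun _ _ => rfl) (fun _ _ => rfl)
    (fun _ _ _ h₁ h₂ => hom_ext fun t => Prod.ext
      (congrArg (fun k => fn k t) h₁) (congrArg (fun k => fn k t) h₂))

end FMn

end Objects

/-! ### Local normal forms of submersions -/

section DifferentialTopology

open Topology Filter

set_option linter.unusedSectionVars false

variable {E : Type} [NormedAddCommGroup E] [NormedSpace ℝ E] [FiniteDimensional ℝ E]
  {H : Type} [TopologicalSpace H] {I : ModelWithCorners ℝ E H} [I.Boundaryless]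
  {M : Type} [TopologicalSpace M] [ChartedSpace H M] [IsManifold I ∞ M]
  {E' : Type} [NormedAddCommGroup E'] [NormedSpace ℝ E'] [FiniteDimensional ℝ E']
  {H' : Type} [TopologicalSpace H'] {I' : ModelWithCorners ℝ E' H'} [I'.Boundaryless]
  {B : Type} [TopologicalSpace B] [ChartedSpace H' B] [IsManifold I' ∞ B]

/-- Every point has arbitrarily small open neighbourhoods diffeomorphic to a Euclidean space. -/
theorem exists_euclidean_chart (I : ModelWithCorners ℝ E H) [I.Boundaryless] [IsManifold I ∞ M]
    (x₀ : M) {O : Set M} (hO : O ∈ 𝓝 x₀) :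
    ∃ (j : EuclideanSpace ℝ (Fin (Module.finrank ℝ E)) → M) (N : Set M)
      (l : M → EuclideanSpace ℝ (Fin (Module.finrank ℝ E))),
      ContMDiff 𝓘(ℝ, EuclideanSpace ℝ (Fin (Module.finrank ℝ E))) I ∞ j ∧ IsOpen N ∧ x₀ ∈ N ∧
      N ⊆ O ∧ ContMDiffOn I 𝓘(ℝ, EuclideanSpace ℝ (Fin (Module.finrank ℝ E))) ∞ l N ∧
      (∀ t, j t ∈ N ∧ l (j t) = t) ∧ ∀ y ∈ N, j (l y) = y := by
  let e : E ≃L[ℝ] EuclideanSpace ℝ (Fin (Module.finrank ℝ E)) := toEuclidean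
  let φ := extChartAt I x₀
  have hO' : ∀ᶠ z in 𝓝 (φ x₀), ∃ p ∈ φ.source, φ p = z ∧ p ∈ O :=
    eventually_nhds_extChartAt (I := I) hO
  have hO'' : ∀ᶠ w in 𝓝 (e (φ x₀)), ∃ p ∈ φ.source, φ p = e.symm w ∧ p ∈ O := by
    refine (e.symm.continuous.tendsto (e (φ x₀))).eventually
      (p := fun z => ∃ p ∈ φ.source, φ p = z ∧ p ∈ O) ?_
    rw [e.symm_apply_apply]
    exact hO'
  obtain ⟨r, hr, hball⟩ := Metric.eventually_nhds_iff_ball.mp hO''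
  -- Replacing a small coordinate ball by all of Euclidean space makes `j` globally defined, so that
  -- test objects are vector spaces rather than open submanifolds.
  let u := OpenPartialHomeomorph.univBall (e (φ x₀)) r
  have hu_mem : ∀ t, u t ∈ Metric.ball (e (φ x₀)) r := fun t => by
    have := u.map_source (x := t) (by simp [u, OpenPartialHomeomorph.univBall_source])
    rwa [OpenPartialHomeomorph.univBall_target _ hr] at this
  have hu_left : ∀ t, u.symm (u t) = t := fun t =>
    u.left_inv (by simp [u, OpenPartialHomeomorph.univBall_source])
  have hu_right : ∀ w ∈ Metric.ball (e (φ x₀)) r, u (u.symm w) = w := fun w hw =>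
    u.right_inv (by rwa [OpenPartialHomeomorph.univBall_target _ hr])
  have hφ : ∀ w ∈ Metric.ball (e (φ x₀)) r, e.symm w ∈ φ.target := by
    intro w hw
    obtain ⟨p, hp, hpw, -⟩ := hball w hw
    rw [← hpw]
    exact φ.map_source hp
  refine ⟨fun t => φ.symm (e.symm (u t)), φ.source ∩ (fun y => e (φ y)) ⁻¹' Metric.ball (e (φ x₀)) r,
    fun y => u.symm (e (φ y)), ?_, ?_, ?_, ?_, ?_, ?_, ?_⟩
  · have h1 : ContMDiff 𝓘(ℝ, EuclideanSpace ℝ (Fin (Module.finrank ℝ E))) 𝓘(ℝ, E) ∞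
        (fun t => e.symm (u t)) :=
      (e.symm.contDiff.comp OpenPartialHomeomorph.contDiff_univBall).contMDiff
    have h2 := (contMDiffOn_extChartAt_symm (I := I) (n := ∞) x₀).comp h1.contMDiffOn (s := Set.univ)
      (fun t _ => hφ _ (hu_mem t))
    exact contMDiffOn_univ.mp h2
  · exact (continuousOn_extChartAt (I := I) x₀).isOpen_inter_preimage
      (isOpen_extChartAt_source x₀) (Metric.isOpen_ball.preimage e.continuous)
  · exact ⟨mem_extChartAt_source x₀, Metric.mem_ball_self hr⟩
  · rintro y ⟨hy, hyb⟩
    obtain ⟨p, hp, hpw, hpO⟩ := hball _ hyb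
    rw [e.symm_apply_apply] at hpw
    rwa [← φ.injOn hp hy hpw]
  · have h1 : ContMDiffOn I 𝓘(ℝ, EuclideanSpace ℝ (Fin (Module.finrank ℝ E))) ∞
        (fun y => e (φ y)) φ.source :=
      e.contDiff.contMDiff.comp_contMDiffOn (contMDiffOn_extChartAt.mono (by simp [φ]))
    have h2 : ContMDiffOn 𝓘(ℝ, EuclideanSpace ℝ (Fin (Module.finrank ℝ E)))
        𝓘(ℝ, EuclideanSpace ℝ (Fin (Module.finrank ℝ E))) ∞ u.symm (Metric.ball (e (φ x₀)) r) :=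
      OpenPartialHomeomorph.contDiffOn_univBall_symm.contMDiffOn
    exact h2.comp (h1.mono Set.inter_subset_left) fun y hy => hy.2
  · intro t
    have h1 := hφ _ (hu_mem t)
    have h2 : φ (φ.symm (e.symm (u t))) = e.symm (u t) := φ.right_inv h1
    refine ⟨⟨φ.map_target h1, ?_⟩, ?_⟩
    · change e (φ (φ.symm (e.symm (u t)))) ∈ Metric.ball (e (φ x₀)) r
      rw [h2, e.apply_symm_apply]
      exact hu_mem t
    · change u.symm (e (φ (φ.symm (e.symm (u t))))) = t
      rw [h2, e.apply_symm_apply, hu_left]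
  · rintro y ⟨hy, hyb⟩
    change φ.symm (e.symm (u (u.symm (e (φ y))))) = y
    rw [hu_right _ hyb, e.symm_apply_apply, φ.left_inv hy]

/-- The local normal form of a submersion. -/
theorem exists_submersion_normal_form {π : M → B} (hπ : Manifold.IsSubmersion I I' ∞ π) (y₀ : M) :
    ∃ (F : Type) (_ : NormedAddCommGroup F) (_ : NormedSpace ℝ F) (_ : FiniteDimensional ℝ F)
      (O : Set (B × F)) (σ : B × F → M) (N : Set M) (r : M → F),
      Module.finrank ℝ E' + Module.finrank ℝ F = Module.finrank ℝ E ∧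
      IsOpen O ∧ ContMDiffOn (I'.prod 𝓘(ℝ, F)) I ∞ σ O ∧ IsOpen N ∧ y₀ ∈ N ∧
      ContMDiffOn I 𝓘(ℝ, F) ∞ r N ∧ (∀ y ∈ N, (π y, r y) ∈ O ∧ σ (π y, r y) = y) ∧
      ∀ p ∈ O, σ p ∈ N ∧ π (σ p) = p.1 ∧ r (σ p) = p.2 := by
  obtain ⟨F, hF₁, hF₂, h⟩ := hπ.isSubmersionAt y₀
  have hfin : FiniteDimensional ℝ (E' × F) := LinearEquiv.finiteDimensional h.equiv.toLinearEquiv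
  have hfinF : FiniteDimensional ℝ F :=
    Module.Finite.of_surjective (LinearMap.snd ℝ E' F) Prod.snd_surjective
  let d := h.domChart.extend I
  let c := h.codChart.extend I'
  have hd : d.source = h.domChart.source := h.domChart.extend_source
  have hc : c.source = h.codChart.source := h.codChart.extend_source
  have hsub : ∀ y ∈ d.source, π y ∈ c.source := by
    rw [hd, hc]
    exact h.source_subset_preimage_source
  have hw : ∀ z ∈ d.target, c (π (d.symm z)) = (h.equiv z).1 := h.writtenInCharts
  have hcont_c : ContMDiffOn I' 𝓘(ℝ, E') ∞ c c.source := by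
    rw [hc]
    exact OpenPartialHomeomorph.contMDiffOn_extend h.codChart_mem_maximalAtlas
  have hcont_d : ContMDiffOn I 𝓘(ℝ, E) ∞ d d.source := by
    rw [hd]
    exact OpenPartialHomeomorph.contMDiffOn_extend h.domChart_mem_maximalAtlas
  have hcont_ds : ContMDiffOn 𝓘(ℝ, E) I ∞ d.symm d.target := by
    have := contMDiffOn_extend_symm h.domChart_mem_maximalAtlas
    rwa [← h.domChart.extend_target'] at this
  have hcs : IsOpen (c.source ×ˢ (Set.univ : Set F)) :=
    (h.codChart.isOpen_extend_source).prod isOpen_univ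
  have hκ : ContMDiffOn (I'.prod 𝓘(ℝ, F)) 𝓘(ℝ, E) ∞
      (fun p : B × F => h.equiv.symm (c p.1, p.2)) (c.source ×ˢ Set.univ) := by
    have h1 : ContMDiffOn (I'.prod 𝓘(ℝ, F)) 𝓘(ℝ, E' × F) ∞ (fun p : B × F => (c p.1, p.2))
        (c.source ×ˢ Set.univ) :=
      (hcont_c.comp contMDiffOn_fst fun p hp => hp.1).prodMk_space contMDiffOn_snd
    exact h.equiv.symm.contDiff.contMDiff.comp_contMDiffOn h1
  -- `r` is the fibre coordinate in the chart of `M`, and `σ (b, w)` is the point with base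
  -- coordinates `c b` and fibre coordinate `w`.
  refine ⟨F, hF₁, hF₂, hfinF,
    (c.source ×ˢ Set.univ) ∩ (fun p : B × F => h.equiv.symm (c p.1, p.2)) ⁻¹' d.target,
    fun p => d.symm (h.equiv.symm (c p.1, p.2)), d.source, fun y => (h.equiv (d y)).2,
    ?_, ?_, ?_, ?_, ?_, ?_, ?_, ?_⟩
  · rw [← Module.finrank_prod]
    exact h.equiv.toLinearEquiv.finrank_eq.symm
  · exact hκ.continuousOn.isOpen_inter_preimage hcs h.domChart.isOpen_extend_target
  · exact hcont_ds.comp (hκ.mono Set.inter_subset_left) fun p hp => hp.2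
  · exact h.domChart.isOpen_extend_source
  · rw [hd]
    exact h.mem_domChart_source
  · exact (contDiff_snd.comp h.equiv.contDiff).contMDiff.comp_contMDiffOn hcont_d
  · intro y hy
    have h1 : h.equiv.symm (c (π y), (h.equiv (d y)).2) = d y := by
      rw [h.equiv.symm_apply_eq]
      refine Prod.ext ?_ rfl
      have := hw (d y) (d.map_source hy)
      rwa [d.left_inv hy] at this
    refine ⟨⟨⟨hsub y hy, trivial⟩, ?_⟩, ?_⟩
    · change h.equiv.symm (c (π y), (h.equiv (d y)).2) ∈ d.target
      rw [h1]
      exact d.map_source hy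
    · change d.symm (h.equiv.symm (c (π y), (h.equiv (d y)).2)) = y
      rw [h1, d.left_inv hy]
  · rintro ⟨b, w⟩ ⟨⟨hb, -⟩, hz⟩
    change h.equiv.symm (c b, w) ∈ d.target at hz
    have h1 := d.map_target hz
    refine ⟨h1, ?_, ?_⟩
    · apply c.injOn (hsub _ h1) hb
      change c (π (d.symm (h.equiv.symm (c b, w)))) = c b
      rw [hw _ hz, h.equiv.apply_symm_apply]
    · change (h.equiv (d (d.symm (h.equiv.symm (c b, w))))).2 = w
      rw [d.right_inv hz, h.equiv.apply_symm_apply]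

/-- Submersions have local sections. -/
theorem exists_local_section {π : M → B} (hπ : Manifold.IsSubmersion I I' ∞ π) (y₀ : M) :
    ∃ (U : Set B) (s : B → M), IsOpen U ∧ π y₀ ∈ U ∧ ContMDiffOn I' I ∞ s U ∧ s (π y₀) = y₀ ∧
      ∀ b ∈ U, π (s b) = b := by
  obtain ⟨F, _, _, _, O, σ, N, r, -, hO, hσ, hN, hyN, hr, hNO, hON⟩ :=
    exists_submersion_normal_form hπ y₀
  have hmk : ContMDiff I' (I'.prod 𝓘(ℝ, F)) ∞ fun b : B => (b, r y₀) :=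
    contMDiff_id.prodMk contMDiff_const
  refine ⟨(fun b => (b, r y₀)) ⁻¹' O, fun b => σ (b, r y₀), hO.preimage hmk.continuous,
    (hNO y₀ hyN).1, hσ.comp hmk.contMDiffOn fun b hb => hb, (hNO y₀ hyN).2,
    fun b hb => (hON _ hb).2.1⟩

theorem surjective_mfderiv_of_rightInverse {f : M → B} {g : B → M} {b : B} {y : M} (hy : g b = y)
    (hf : MDifferentiableAt I I' f y) (hg : MDifferentiableAt I' I g b)
    (hfg : ∀ᶠ b' in 𝓝 b, f (g b') = b') : Function.Surjective (mfderiv I I' f y) := by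
  subst hy
  have h1 := mfderiv_comp b hf hg
  have h2 : f ∘ g =ᶠ[𝓝 b] id := hfg
  rw [h2.mfderiv_eq, mfderiv_id] at h1
  intro w
  exact ⟨mfderiv I' I g b w, (congrArg (fun A : E' →L[ℝ] E' => A w) h1).symm⟩

theorem surjective_mfderiv_of_isSubmersion {π : M → B} (hπ : Manifold.IsSubmersion I I' ∞ π)
    (y : M) : Function.Surjective (mfderiv I I' π y) := by
  obtain ⟨U, s, hU, hyU, hs, hsy, hsU⟩ := exists_local_section hπ y
  exact surjective_mfderiv_of_rightInverse hsy
    ((hπ.contMDiff.contMDiffAt (x := y)).mdifferentiableAt (by simp))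
    ((hs.contMDiffAt (hU.mem_nhds hyU)).mdifferentiableAt (by simp))
    (Filter.eventually_of_mem (hU.mem_nhds hyU) hsU)

/-- The fibre product of a submersion with itself is locally diffeomorphic to a Euclidean space. -/
theorem exists_local_fiber_product {π : M → B} (hπ : Manifold.IsSubmersion I I' ∞ π) {x₀ y₀ : M}
    (h₀ : π x₀ = π y₀) :
    ∃ (n : ℕ) (p q : EuclideanSpace ℝ (Fin n) → M) (N : Set (M × M))
      (l : M × M → EuclideanSpace ℝ (Fin n)),
      Module.finrank ℝ E' + n = Module.finrank ℝ E + Module.finrank ℝ E ∧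
      ContMDiff 𝓘(ℝ, EuclideanSpace ℝ (Fin n)) I ∞ p ∧
      ContMDiff 𝓘(ℝ, EuclideanSpace ℝ (Fin n)) I ∞ q ∧ IsOpen N ∧ (x₀, y₀) ∈ N ∧
      ContMDiffOn (I.prod I) 𝓘(ℝ, EuclideanSpace ℝ (Fin n)) ∞ l N ∧
      (∀ t, π (p t) = π (q t) ∧ (p t, q t) ∈ N ∧ l (p t, q t) = t) ∧
      ∀ x y, (x, y) ∈ N → π x = π y → p (l (x, y)) = x ∧ q (l (x, y)) = y := by
  obtain ⟨F, _, _, _, O, σ, S, r, hdim, hO, hσ, hS, hyS, hr, hSO, hOS⟩ :=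
    exists_submersion_normal_form hπ y₀
  -- For `y` near `y₀`, a pair with `π x = π y` is determined by `x` and the fibre coordinate `w = r
  -- y`, through `y = σ (π x, w)`. A Euclidean chart of `M × F` at `(x₀, r y₀)` thus parametrizes
  -- the fibre product.
  have hπF : ContMDiff (I.prod 𝓘(ℝ, F)) (I'.prod 𝓘(ℝ, F)) ∞ fun p : M × F => (π p.1, p.2) :=
    (hπ.contMDiff.comp contMDiff_fst).prodMk contMDiff_snd
  have hO' : (fun p : M × F => (π p.1, p.2)) ⁻¹' O ∈ 𝓝 (x₀, r y₀) := by
    apply (hO.preimage hπF.continuous).mem_nhds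
    change (π x₀, r y₀) ∈ O
    rw [h₀]
    exact (hSO y₀ hyS).1
  obtain ⟨j, N', l', hj, hN', hxN', hN'O, hl', hjN', hN'j⟩ :=
    exists_euclidean_chart (I.prod 𝓘(ℝ, F)) (x₀, r y₀) hO'
  have hrr : ContMDiffOn (I.prod I) (I.prod 𝓘(ℝ, F)) ∞ (fun z : M × M => (z.1, r z.2))
      (Set.univ ×ˢ S) :=
    contMDiffOn_fst.prodMk (hr.comp contMDiffOn_snd fun z hz => hz.2)
  refine ⟨_, fun t => (j t).1, fun t => σ (π (j t).1, (j t).2),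
    (Set.univ ×ˢ S) ∩ (fun z : M × M => (z.1, r z.2)) ⁻¹' N', fun z => l' (z.1, r z.2),
    ?_, contMDiff_fst.comp hj, ?_, ?_, ?_, ?_, ?_, ?_⟩
  · rw [Module.finrank_prod, ← hdim]
    ring
  · exact contMDiffOn_univ.mp (hσ.comp (hπF.comp hj).contMDiffOn fun t _ => hN'O (hjN' t).1)
  · exact hrr.continuousOn.isOpen_inter_preimage (isOpen_univ.prod hS) hN'
  · exact ⟨⟨trivial, hyS⟩, hxN'⟩
  · exact hl'.comp (hrr.mono Set.inter_subset_left) fun z hz => hz.2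
  · intro t
    obtain ⟨h1, h2, h3⟩ := hOS _ (hN'O (hjN' t).1)
    simp only at h1 h2 h3
    refine ⟨h2.symm, ⟨⟨trivial, h1⟩, ?_⟩, ?_⟩
    · change ((j t).1, r (σ (π (j t).1, (j t).2))) ∈ N'
      rw [h3]
      exact (hjN' t).1
    · change l' ((j t).1, r (σ (π (j t).1, (j t).2))) = t
      rw [h3]
      exact (hjN' t).2
  · rintro x y ⟨⟨-, hy⟩, hxy⟩ hπxy
    have h1 : j (l' (x, r y)) = (x, r y) := hN'j _ hxy
    simp only [h1, hπxy]
    exact ⟨trivial, (hSO y hy).2⟩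

end DifferentialTopology

/-! ### Local test objects -/

section FiberProductAlgebra

variable {V E F : Type*} [AddCommGroup V] [Module ℝ V]
  [AddCommGroup E] [Module ℝ E] [AddCommGroup F] [Module ℝ F]

/-- `V` embeds in the fibre product, the kernel of `(a, b) ↦ A a - B b`. Surjectivity of `B` gives
this kernel dimension `2 dim E - dim F = dim V`, so the embedding is onto. -/
theorem exists_of_finrank_fiber_product [FiniteDimensional ℝ E] {P Q : V →ₗ[ℝ] E} {A B : E →ₗ[ℝ] F}
    (hAB : ∀ v, A (P v) = B (Q v)) (hinj : ∀ v, P v = 0 → Q v = 0 → v = 0)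
    (hB : Function.Surjective B)
    (hdim : Module.finrank ℝ F + Module.finrank ℝ V = Module.finrank ℝ E + Module.finrank ℝ E)
    {a b : E} (hab : A a = B b) : ∃ v, P v = a ∧ Q v = b := by
  let S : E × E →ₗ[ℝ] F := A.comp (LinearMap.fst ℝ E E) - B.comp (LinearMap.snd ℝ E E)
  have hS : ∀ x, S x = A x.1 - B x.2 := fun x => rfl
  have hSs : Function.Surjective S := fun w => by
    obtain ⟨u, hu⟩ := hB (-w)
    exact ⟨(0, u), by rw [hS, map_zero, hu]; simp⟩
  have h1 := S.finrank_range_add_finrank_ker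
  rw [LinearMap.range_eq_top.mpr hSs, finrank_top, Module.finrank_prod, ← hdim] at h1
  have hinj' : Function.Injective (P.prod Q) := by
    rw [← LinearMap.ker_eq_bot, LinearMap.ker_eq_bot']
    intro v hv
    exact hinj v (congrArg Prod.fst hv) (congrArg Prod.snd hv)
  have h2 : LinearMap.range (P.prod Q) = LinearMap.ker S := by
    apply Submodule.eq_of_le_of_finrank_eq
    · rintro _ ⟨v, rfl⟩
      rw [LinearMap.mem_ker, hS]
      exact sub_eq_zero.mpr (hAB v)
    · rw [LinearMap.finrank_range_of_inj hinj']
      exact (Nat.add_left_cancel h1).symm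
  have h3 : (a, b) ∈ LinearMap.range (P.prod Q) := by
    rw [h2, LinearMap.mem_ker, hS]
    exact sub_eq_zero.mpr hab
  obtain ⟨v, hv⟩ := h3
  exact ⟨v, congrArg Prod.fst hv, congrArg Prod.snd hv⟩

theorem finrank_eq_of_bijOn {K : Submodule ℝ V} {L : Submodule ℝ E} (P : V →ₗ[ℝ] E)
    (h : Set.BijOn P K L) : Module.finrank ℝ K = Module.finrank ℝ L := by
  refine LinearEquiv.finrank_eq (LinearEquiv.ofBijective (P.restrict h.mapsTo) ⟨?_, ?_⟩)
  · intro x y hxy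
    exact Subtype.ext (h.injOn x.2 y.2 (congrArg Subtype.val hxy))
  · intro y
    obtain ⟨x, hx, hxy⟩ := h.surjOn y.2
    exact ⟨⟨x, hx⟩, Subtype.ext hxy⟩

/-- Subspaces of a fibre product of vector spaces. -/
theorem bijOn_fiber_product {P Q : V →ₗ[ℝ] E} {A B : E →ₗ[ℝ] F}
    (hAB : ∀ v, A (P v) = B (Q v)) (hinj : ∀ v, P v = 0 → Q v = 0 → v = 0)
    (hex : ∀ a b, A a = B b → ∃ v, P v = a ∧ Q v = b)
    {K L : Submodule ℝ E} {D : Submodule ℝ F} (hK : Set.BijOn A K D) (hL : Set.BijOn B L D) :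
    Set.BijOn P (K.comap P ⊓ L.comap Q : Submodule ℝ V) K := by
  refine ⟨fun v hv => hv.1, ?_, ?_⟩
  · intro v hv w hw hvw
    have h1 : Q v = Q w := hL.injOn hv.2 hw.2 (by rw [← hAB, ← hAB, hvw])
    exact sub_eq_zero.mp (hinj _ (by rw [map_sub, hvw, sub_self]) (by rw [map_sub, h1, sub_self]))
  · intro a ha
    obtain ⟨b, hb, hab⟩ := hL.surjOn (hK.mapsTo ha)
    obtain ⟨v, rfl, rfl⟩ := hex a b hab.symm
    exact ⟨v, ⟨ha, hb⟩, rfl⟩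

end FiberProductAlgebra

namespace FMn

section TestObjects

open Topology Filter

/-- Morphisms onto a foliation of the same rank are partial connections. -/
theorem isPartialConnection_of_rank {M B : FMn} (π : M ⟶ B) (h : M.fol.rank = B.fol.rank) :
    IsPartialConnection π := by
  intro p
  have h1 : FiniteDimensional ℝ (TangentSpace M.I p) := inferInstanceAs (FiniteDimensional ℝ M.E)
  have h2 : FiniteDimensional ℝ (TangentSpace B.I (fn π p)) :=
    inferInstanceAs (FiniteDimensional ℝ B.E)
  have hm : ∀ v ∈ M.fol.D p, diff (fn π) p v ∈ B.fol.D (fn π p) := fun v hv => diff_fn_mem π hv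
  refine ⟨hm, ?_, fun w hw => exists_diff_fn_eq π hw⟩
  have hs : Function.Surjective ((diff (fn π) p).restrict hm) := by
    rintro ⟨w, hw⟩
    obtain ⟨v, hv, hvw⟩ := exists_diff_fn_eq π hw
    exact ⟨⟨v, hv⟩, Subtype.ext hvw⟩
  have hi := (LinearMap.injective_iff_surjective_of_finrank_eq_finrank (by
    rw [M.fol.finrank_eq, B.fol.finrank_eq, h])).mpr hs
  intro v hv w hw hvw
  exact congrArg Subtype.val (@hi ⟨v, hv⟩ ⟨w, hw⟩ (Subtype.ext hvw))

/-- A Euclidean space with a foliation. -/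
noncomputable def euclidean (n : ℕ)
    (F : Foliation 𝓘(ℝ, EuclideanSpace ℝ (Fin n)) (EuclideanSpace ℝ (Fin n))) : FMn where
  E := EuclideanSpace ℝ (Fin n)
  H := EuclideanSpace ℝ (Fin n)
  I := 𝓘(ℝ, EuclideanSpace ℝ (Fin n))
  carrier := EuclideanSpace ℝ (Fin n)
  fol := F

/-- Every point is in the image of a morphism with values in a given neighbourhood. -/
theorem exists_local_object (X : FMn) (x₀ : X) {O : Set X} (hO : O ∈ 𝓝 x₀) :
    ∃ (W : FMn) (j : W ⟶ X) (w₀ : W), fn j w₀ = x₀ ∧ ∀ w, fn j w ∈ O := by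
  obtain ⟨j, N, l, hj, hN, hxN, hNO, hl, hjN, hlN⟩ := exists_euclidean_chart X.I x₀ hO
  have hsurj : ∀ t, Function.Surjective
      (mfderiv 𝓘(ℝ, EuclideanSpace ℝ (Fin (Module.finrank ℝ X.E))) X.I j t) := fun t =>
    surjective_mfderiv_of_rightInverse (hjN t).2
      ((hj.contMDiffAt (x := t)).mdifferentiableAt (by simp))
      ((hl.contMDiffAt (hN.mem_nhds (hjN t).1)).mdifferentiableAt (by simp))
      (Filter.eventually_of_mem (hN.mem_nhds (hjN t).1) hlN)
  -- `Foliation.pullback₂` is applied with both maps equal to `j`, so the intersection is just the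
  -- pullback by the local diffeomorphism `j`.
  have hfin : ∀ t, Module.finrank ℝ ((pullbackDist (I := 𝓘(ℝ, EuclideanSpace ℝ (Fin
      (Module.finrank ℝ X.E)))) j X.fol t ⊓ pullbackDist j X.fol t : Submodule ℝ (TangentSpace
        𝓘(ℝ, EuclideanSpace ℝ (Fin (Module.finrank ℝ X.E))) t))) = X.fol.rank := by
    intro t
    rw [inf_idem, ← X.fol.finrank_eq (j t)]
    have hd : Module.finrank ℝ (EuclideanSpace ℝ (Fin (Module.finrank ℝ X.E))) =
      Module.finrank ℝ X.E := finrank_euclideanSpace_fin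
    have hinj : Function.Injective
        (mfderiv 𝓘(ℝ, EuclideanSpace ℝ (Fin (Module.finrank ℝ X.E))) X.I j t) :=
      (LinearMap.injective_iff_surjective_of_finrank_eq_finrank
        (V := EuclideanSpace ℝ (Fin (Module.finrank ℝ X.E))) (V₂ := X.E)
        (f := (mfderiv 𝓘(ℝ, EuclideanSpace ℝ (Fin (Module.finrank ℝ X.E))) X.I j t).toLinearMap)
        hd).mpr (hsurj t)
    exact finrank_eq_of_bijOn (V := EuclideanSpace ℝ (Fin (Module.finrank ℝ X.E))) (E := X.E)
      (mfderiv 𝓘(ℝ, EuclideanSpace ℝ (Fin (Module.finrank ℝ X.E))) X.I j t).toLinearMap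
      ⟨fun v hv => hv, hinj.injOn, fun w hw => by
        obtain ⟨v, rfl⟩ := hsurj t w
        exact ⟨v, hw, rfl⟩⟩
  refine ⟨euclidean _ (Foliation.pullback₂ hj hj X.fol X.fol _ hfin),
    mkHom (M := euclidean _ (Foliation.pullback₂ hj hj X.fol X.fol _ hfin)) j hj
      (fun t v hv => hv.1) (fun t w hw => ?_), l x₀, hlN x₀ hxN, fun w => hNO (hjN w).1⟩
  obtain ⟨v, rfl⟩ := hsurj t w
  exact ⟨v, ⟨hw, hw⟩, rfl⟩

/-- The kernel pair of a submersion, near a point. -/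
theorem exists_local_kernel_pair {M B : FMn} (π : M ⟶ B)
    (hπ : Manifold.IsSubmersion M.I B.I ∞ (fn π)) (hconn : IsPartialConnection π) {x₀ y₀ : M}
    (h₀ : fn π x₀ = fn π y₀) :
    ∃ (T : FMn) (p q : T ⟶ M) (N : Set (M × M)) (l : M × M → T), p ≫ π = q ≫ π ∧ IsOpen N ∧
      (x₀, y₀) ∈ N ∧ ContMDiffOn (M.I.prod M.I) T.I ∞ l N ∧
      (∀ x y, (x, y) ∈ N → fn π x = fn π y → fn p (l (x, y)) = x ∧ fn q (l (x, y)) = y) ∧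
      ∀ (W : FMn) (f h : W ⟶ M), f ≫ π = h ≫ π → (∀ w, (fn f w, fn h w) ∈ N) →
        ∃ k : W ⟶ T, ∀ w, fn k w = l (fn f w, fn h w) := by
  obtain ⟨n, p, q, N, l, hdim, hp, hq, hN, hxyN, hl, hpqN, hlN⟩ := exists_local_fiber_product hπ h₀
  have hdp : ∀ t, MDifferentiableAt 𝓘(ℝ, EuclideanSpace ℝ (Fin n)) M.I p t := fun t =>
    (hp.contMDiffAt (x := t)).mdifferentiableAt (by simp)
  have hdq : ∀ t, MDifferentiableAt 𝓘(ℝ, EuclideanSpace ℝ (Fin n)) M.I q t := fun t =>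
    (hq.contMDiffAt (x := t)).mdifferentiableAt (by simp)
  let P : EuclideanSpace ℝ (Fin n) → EuclideanSpace ℝ (Fin n) →L[ℝ] M.E := fun t =>
    mfderiv 𝓘(ℝ, EuclideanSpace ℝ (Fin n)) M.I p t
  let Q : EuclideanSpace ℝ (Fin n) → EuclideanSpace ℝ (Fin n) →L[ℝ] M.E := fun t =>
    mfderiv 𝓘(ℝ, EuclideanSpace ℝ (Fin n)) M.I q t
  let A : M → M.E →L[ℝ] B.E := fun x => mfderiv M.I B.I (fn π) x
  have hdπ : ∀ x, MDifferentiableAt M.I B.I (fn π) x := fun x =>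
    ((contMDiff_fn π).contMDiffAt (x := x)).mdifferentiableAt (by simp)
  have hAB : ∀ t v, A (p t) (P t v) = A (q t) (Q t v) := by
    intro t v
    have h1 := mfderiv_comp t (hdπ (p t)) (hdp t)
    have h2 := mfderiv_comp t (hdπ (q t)) (hdq t)
    have h3 : fn π ∘ p = fn π ∘ q := funext fun t => (hpqN t).1
    rw [h3] at h1
    exact congrArg (fun L : EuclideanSpace ℝ (Fin n) →L[ℝ] B.E => L v) (h1.symm.trans h2)
  have hinj : ∀ t v, P t v = 0 → Q t v = 0 → v = 0 := by
    intro t v hPv hQv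
    have h1 := mfderiv_comp t ((hl.contMDiffAt (hN.mem_nhds (hpqN t).2.1)).mdifferentiableAt (by simp))
      ((hdp t).prodMk (hdq t))
    have h2 : l ∘ (fun t => (p t, q t)) = id := funext fun t => (hpqN t).2.2
    rw [h2, mfderiv_id] at h1
    have h3 := congrArg (fun L : EuclideanSpace ℝ (Fin n) →L[ℝ] EuclideanSpace ℝ (Fin n) => L v) h1
    have h4 : (mfderiv 𝓘(ℝ, EuclideanSpace ℝ (Fin n)) (M.I.prod M.I) (fun t => (p t, q t)) t :
        EuclideanSpace ℝ (Fin n) →L[ℝ] M.E × M.E) v = (P t v, Q t v) :=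
      congrArg (fun L : EuclideanSpace ℝ (Fin n) →L[ℝ] M.E × M.E => L v)
        (mfderiv_prodMk (hdp t) (hdq t))
    rw [hPv, hQv] at h4
    refine h3.trans ?_
    refine (congrArg (mfderiv (M.I.prod M.I) 𝓘(ℝ, EuclideanSpace ℝ (Fin n)) l (p t, q t)) h4).trans ?_
    exact map_zero (mfderiv (M.I.prod M.I) 𝓘(ℝ, EuclideanSpace ℝ (Fin n)) l (p t, q t))
  -- The tangent space of the model is the whole fibre product of the two tangent spaces, by the
  -- dimension count.
  have hex : ∀ t a b, A (p t) a = A (q t) b → ∃ v, P t v = a ∧ Q t v = b := fun t a b hab =>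
    exists_of_finrank_fiber_product (P := (P t).toLinearMap) (Q := (Q t).toLinearMap)
      (A := (A (p t)).toLinearMap) (B := (A (q t)).toLinearMap) (hAB t) (hinj t)
      (surjective_mfderiv_of_isSubmersion hπ (q t)) (by rw [finrank_euclideanSpace_fin, hdim]) hab
  let DM : M → Submodule ℝ M.E := fun x => M.fol.D x
  let DB : B → Submodule ℝ B.E := fun b => B.fol.D b
  have hKL : ∀ t, Set.BijOn (A (q t)) (DM (q t)) (DB (fn π (p t))) := by
    intro t
    rw [(hpqN t).1]
    exact hconn (q t)
  let D : ∀ t, Submodule ℝ (EuclideanSpace ℝ (Fin n)) := fun t =>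
    Submodule.comap (P t).toLinearMap (DM (p t)) ⊓
      Submodule.comap (Q t).toLinearMap (DM (q t))
  -- Since `dπ` is bijective from `F` to `D`, each vector of `F` at `p t` has exactly one partner in
  -- `F` at `q t` over the same vector of `D`. Hence the intersection of the pullbacks has constant
  -- rank and projects isomorphically onto `F` on both sides.
  have hP : ∀ t, Set.BijOn (P t) (D t) (DM (p t)) := fun t =>
    bijOn_fiber_product (V := EuclideanSpace ℝ (Fin n)) (E := M.E) (F := B.E)
      (P := (P t).toLinearMap) (Q := (Q t).toLinearMap)
      (A := (A (p t)).toLinearMap) (B := (A (q t)).toLinearMap) (hAB t) (hinj t) (hex t)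
      (hconn (p t)) (hKL t)
  have hQ : ∀ t, Set.BijOn (Q t) (D t) (DM (q t)) := fun t => by
    have h1 := bijOn_fiber_product (V := EuclideanSpace ℝ (Fin n)) (E := M.E) (F := B.E)
      (P := (Q t).toLinearMap) (Q := (P t).toLinearMap)
      (A := (A (q t)).toLinearMap) (B := (A (p t)).toLinearMap) (fun v => (hAB t v).symm)
      (fun v hv hw => hinj t v hw hv)
      (fun a b hab => (hex t b a hab.symm).imp fun v hv => hv.symm)
      (hKL t) (hconn (p t))
    rw [inf_comm] at h1
    exact h1
  have hfin : ∀ t, Module.finrank ℝ ((pullbackDist (I := 𝓘(ℝ, EuclideanSpace ℝ (Fin n)))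
      p M.fol t ⊓ pullbackDist q M.fol t : Submodule ℝ (TangentSpace
        𝓘(ℝ, EuclideanSpace ℝ (Fin n)) t))) = M.fol.rank := fun t =>
    (finrank_eq_of_bijOn (V := EuclideanSpace ℝ (Fin n)) (E := M.E) (P t).toLinearMap
      (hP t)).trans (M.fol.finrank_eq (p t))
  let T : FMn := euclidean n (Foliation.pullback₂ hp hq M.fol M.fol _ hfin)
  let p' : T ⟶ M := mkHom (M := T) p hp (fun t v hv => (hP t).mapsTo hv)
    (fun t w hw => (hP t).surjOn hw)
  let q' : T ⟶ M := mkHom (M := T) q hq (fun t v hv => (hQ t).mapsTo hv)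
    (fun t w hw => (hQ t).surjOn hw)
  refine ⟨T, p', q', N, l, hom_ext fun t => (hpqN t).1, hN, hxyN, hl, hlN, fun W f h hfh hW => ?_⟩
  let k : W → T := fun w => l (fn f w, fn h w)
  have hk : ContMDiff W.I T.I ∞ k :=
    contMDiffOn_univ.mp (hl.comp ((contMDiff_fn f).prodMk (contMDiff_fn h)).contMDiffOn
      fun w _ => hW w)
  have hpk : fn p' ∘ k = fn f := funext fun w =>
    (hlN _ _ (hW w) (congrArg (fun k => fn k w) hfh)).1
  have hqk : fn q' ∘ k = fn h := funext fun w =>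
    (hlN _ _ (hW w) (congrArg (fun k => fn k w) hfh)).2
  have hdp' : ∀ w v, diff (fn p') (k w) (diff k w v) = diff (fn f) w v := by
    intro w v
    rw [← diff_comp_apply (contMDiff_fn p') hk, hpk]
  have hdq' : ∀ w v, diff (fn q') (k w) (diff k w v) = diff (fn h) w v := by
    intro w v
    rw [← diff_comp_apply (contMDiff_fn q') hk, hqk]
  have hep : ∀ w, DM (fn p' (k w)) = DM (fn f w) := fun w => congrArg DM (congrFun hpk w)
  have heq : ∀ w, DM (fn q' (k w)) = DM (fn h w) := fun w => congrArg DM (congrFun hqk w)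
  have hkD : ∀ w, ∀ v ∈ W.fol.D w, diff k w v ∈ T.fol.D (k w) := by
    intro w v hv
    have h1 : (diff (fn p') (k w) (diff k w v) : M.E) ∈ DM (fn p' (k w)) := by
      rw [hep w]
      exact Set.mem_of_eq_of_mem (hdp' w v) (diff_fn_mem f hv)
    have h2 : (diff (fn q') (k w) (diff k w v) : M.E) ∈ DM (fn q' (k w)) := by
      rw [heq w]
      exact Set.mem_of_eq_of_mem (hdq' w v) (diff_fn_mem h hv)
    exact ⟨h1, h2⟩
  refine ⟨mkHom k hk hkD fun w u hu => ?_, fun w => rfl⟩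
  -- To reach a direction `u` of the model, lift its first projection through `f`. Injectivity of
  -- `P` on the foliation then forces `dk(v) = u`.
  have hu1 : P (k w) u ∈ DM (fn f w) := by
    rw [← hep w]
    exact hu.1
  obtain ⟨v, hv, hvu⟩ := exists_diff_fn_eq f hu1
  exact ⟨v, hv, (hP (k w)).injOn (hkD w v hv) hu ((hdp' w v).trans hvu)⟩

end TestObjects

end FMn

/-! ### Splitting actions and kernel pairs -/

section Splitting

universe v u

variable {C : Type u} [Category.{v} C] {M B : C} {π : M ⟶ B} {G : GroupObject C}

namespace GroupObjectAction

/-- The identity of `α.prod` is the required isomorphism: in a kernel pair an arrow is determined by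
its source and target, so compatibility with composition is automatic. -/
theorem isSplitting_of_isKernelPair {α : GroupObjectAction G M}
    (h : IsKernelPair π α.snd α.act) : α.IsSplitting (kernelPairGroupoid h) := by
  refine ⟨⟨Iso.refl _, Category.id_comp _, Category.id_comp _, ?_⟩⟩
  intro T b a e e'
  apply h.hom_ext
  · exact (congrArg (· ≫ α.snd) (Category.comp_id _)).trans <| (α.groupoid.comp_s b a e).trans <|
      ((congrArg (· ≫ α.snd) (Category.comp_id a).symm)).trans
        ((kernelPairGroupoid h).comp_s (b ≫ 𝟙 _) (a ≫ 𝟙 _) e').symm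
  · exact (congrArg (· ≫ α.act) (Category.comp_id _)).trans <| (α.groupoid.comp_t b a e).trans <|
      ((congrArg (· ≫ α.act) (Category.comp_id b).symm)).trans
        ((kernelPairGroupoid h).comp_t (b ≫ 𝟙 _) (a ≫ 𝟙 _) e').symm

/-- Only the compatibility with source and target matters. Splitting thus amounts to `α.snd` and
`α.act` forming a kernel pair of `π`, the form used in the sequel. -/
theorem isKernelPair_of_isSplitting {α : GroupObjectAction G M} {K : C} {s t : K ⟶ M}
    {h : IsKernelPair π s t} (hα : α.IsSplitting (kernelPairGroupoid h)) :
    IsKernelPair π α.snd α.act := by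
  obtain ⟨φ⟩ := hα
  let e : α.prod ≅ K := φ.iso
  have hs : e.hom ≫ s = α.snd := φ.map_s
  have ht : e.hom ≫ t = α.act := φ.map_t
  exact IsPullback.of_iso h e.symm (Iso.refl _) (Iso.refl _) (Iso.refl _) (by simp [← hs])
    (by simp [← ht]) (by simp) (by simp)

end GroupObjectAction

end Splitting

/-! ### Lie groups as group objects -/

namespace FMn

open scoped Topology

/-- The object of `FMn` underlying a Lie group, foliated by points. -/
noncomputable def _root_.RealLieGroup.toFMn (G : RealLieGroup) : FMn :=
  haveI : ContMDiffMul G.I ∞ G := inferInstance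
  haveI : IsManifold G.I ∞ G := inferInstance
  { E := G.E
    H := G.H
    I := G.I
    carrier := G
    fol := Foliation.discrete G.I G }

instance (G : RealLieGroup) : Group G.toFMn := inferInstanceAs (Group G)

instance (G : RealLieGroup) : LieGroup G.toFMn.I ∞ G.toFMn := inferInstanceAs (LieGroup G.I ∞ G)

/-- A smooth map between manifolds with foliations of rank zero. -/
def homOfRankZero {M N : FMn} (hM : M.fol.rank = 0) (hN : N.fol.rank = 0) (f : M → N)
    (hf : ContMDiff M.I N.I ∞ f) : M ⟶ N :=
  mkHomDiscrete hN f hf fun p v hv => by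
    rw [D_eq_bot hM, Submodule.mem_bot] at hv
    rw [hv, map_zero]

/-- The multiplication of a Lie group, as a morphism. -/
noncomputable def mulHom (G : RealLieGroup) : prodObj G.toFMn G.toFMn ⟶ G.toFMn :=
  homOfRankZero (by rfl) (by rfl) (fun p => pfst p * psnd p) (contMDiff_mul G.I ∞ (G := G))

noncomputable def invHom (G : RealLieGroup) : G.toFMn ⟶ G.toFMn :=
  homOfRankZero (by rfl) (by rfl) (fun p => p⁻¹) (contMDiff_inv G.I ∞ (G := G))

noncomputable def oneHom (G : RealLieGroup) (T : FMn) : T ⟶ G.toFMn :=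
  mkHomDiscrete (by rfl) (fun _ => (1 : G)) contMDiff_const
    (fun p v _ => by exact congrArg (fun A => A v) (diff_const (M := T) (N := G.toFMn) (1 : G) p))

/-- The group object of `FMn` given by a Lie group. -/
noncomputable def _root_.RealLieGroup.toGroupObject (G : RealLieGroup) : GroupObject FMn where
  X := G.toFMn
  grp T :=
    { mul := fun f g => prodLift (by rfl) f g ≫ mulHom G
      one := oneHom G T
      inv := fun f => f ≫ invHom G
      mul_assoc := fun f g h => hom_ext fun t =>
        mul_assoc (fn f t) (fn g t) (fn h t)
      one_mul := fun f => hom_ext fun t => one_mul (fn f t)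
      mul_one := fun f => hom_ext fun t => mul_one (fn f t)
      inv_mul_cancel := fun f => hom_ext fun t => inv_mul_cancel (fn f t) }
  comp_mul _ _ _ := rfl

end FMn

/-! ### Principal bundles -/

theorem injective_mfderiv_of_leftInverse {E : Type*} [NormedAddCommGroup E] [NormedSpace ℝ E]
    {H : Type*} [TopologicalSpace H] {I : ModelWithCorners ℝ E H} {M : Type*} [TopologicalSpace M]
    [ChartedSpace H M] {E' : Type*} [NormedAddCommGroup E'] [NormedSpace ℝ E'] {H' : Type*}
    [TopologicalSpace H'] {I' : ModelWithCorners ℝ E' H'} {B : Type*} [TopologicalSpace B]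
    [ChartedSpace H' B] {f : M → B} {g : B → M} {y : M}
    (hf : MDifferentiableAt I I' f y) (hg : MDifferentiableAt I' I g (f y))
    (hfg : ∀ y', g (f y') = y') {v : TangentSpace I y} (hv : mfderiv I I' f y v = 0) : v = 0 := by
  have h1 := mfderiv_comp y hg hf
  have h2 : g ∘ f = id := funext hfg
  rw [h2, mfderiv_id] at h1
  have h3 := congrArg (fun A : E →L[ℝ] E => A v) h1
  refine h3.trans ?_
  exact (congrArg (mfderiv I' I g (f y)) hv).trans (map_zero _)

namespace PrincipalStructure

open FMn
open scoped Topology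

variable {M B : FMn} {π : M ⟶ B} (P : PrincipalStructure π)

instance : MulAction P.G.toFMn M := inferInstanceAs (MulAction P.G M)

theorem contMDiff_act : ContMDiff (prodObj P.G.toFMn M).I M.I ∞
    (fun p : prodObj P.G.toFMn M => pfst p • psnd p) := 
  P.principal.smooth_action.contMDiff_smul

theorem fn_smul (g : P.G.toFMn) (x : M) : fn π (g • x) = fn π x := by
  obtain ⟨U, hU, hxU, Φ, hs, ht, hΦ⟩ := P.principal.locally_trivial (fn π x)
  have hx : x ∈ Φ.source := by rw [hs]; exact hxU
  have h1 := (hΦ x hx).2 g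
  exact ((hΦ _ h1.1).1).symm.trans ((congrArg Prod.fst h1.2).trans (hΦ x hx).1)

/-- The group component of a local trivialization. -/
theorem exists_division (b : B) : ∃ (U : Set B) (τ : M → P.G.toFMn), IsOpen U ∧ b ∈ U ∧
    ContMDiffOn M.I P.G.toFMn.I ∞ τ (fn π ⁻¹' U) ∧
    (∀ x, fn π x ∈ U → ∀ g : P.G.toFMn, τ (g • x) = g * τ x) ∧
    ∀ x y, fn π x ∈ U → fn π x = fn π y → τ x = τ y → x = y := by
  obtain ⟨U, hU, hxU, Φ, hs, ht, hΦ⟩ := P.principal.locally_trivial b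
  refine ⟨U, fun x => (Φ x).2, hU, hxU, ?_, ?_, ?_⟩
  · rw [← hs]
    exact contMDiff_snd.comp_contMDiffOn Φ.contMDiffOn
  · intro x hx g
    have hx' : x ∈ Φ.source := by rw [hs]; exact hx
    exact congrArg Prod.snd ((hΦ x hx').2 g).2
  · intro x y hx hxy h
    have hx' : x ∈ Φ.source := by rw [hs]; exact hx
    have hy' : y ∈ Φ.source := by rw [hs]; exact (show fn π y ∈ U from hxy ▸ hx)
    exact Φ.injOn hx' hy' (Prod.ext ((hΦ x hx').1.trans (hxy.trans (hΦ y hy').1.symm)) h)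

theorem smul_right_cancel {g h : P.G.toFMn} {x : M} (e : g • x = h • x) : g = h := by
  obtain ⟨U, τ, hU, hxU, hτ, hg, -⟩ := P.exists_division (fn π x)
  have := congrArg τ e
  rw [hg x hxU, hg x hxU] at this
  exact mul_right_cancel this

theorem exists_smul_eq {x y : M} (h : fn π x = fn π y) : ∃ g : P.G.toFMn, g • x = y := by
  obtain ⟨U, τ, hU, hxU, hτ, hg, hi⟩ := P.exists_division (fn π x)
  refine ⟨τ y * (τ x)⁻¹, hi _ _ ?_ ?_ ?_⟩
  · rw [fn_smul]; exact hxU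
  · rw [fn_smul]; exact h
  · rw [hg x hxU]; group

/-- With `τ` the equivariant group component of a trivialization, `k = τ(k • f) τ(f)⁻¹` locally.
Invariance of `π` keeps `k • f` in the domain of `τ`, so continuity of `k` is not presupposed. -/
theorem contMDiff_of_smul {T : FMn} {k : T → P.G.toFMn} {f : T → M}
    (hf : ContMDiff T.I M.I ∞ f) (hh : ContMDiff T.I M.I ∞ (fun t => k t • f t)) :
    ContMDiff T.I P.G.toFMn.I ∞ k := by
  intro t
  obtain ⟨U, τ, hU, hxU, hτ, hg, -⟩ := P.exists_division (fn π (f t))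
  have hV : IsOpen (fn π ⁻¹' U) := hU.preimage (contMDiff_fn π).continuous
  have hkt : fn π (k t • f t) ∈ U := by rw [fn_smul]; exact hxU
  have h1 : ContMDiffAt T.I P.G.toFMn.I ∞ (fun s => τ (f s)) t :=
    (hτ.contMDiffAt (hV.mem_nhds hxU)).comp t (hf t)
  have h2 : ContMDiffAt T.I P.G.toFMn.I ∞ (fun s => τ (k s • f s)) t :=
    (hτ.contMDiffAt (hV.mem_nhds hkt)).comp t (hh t)
  have h3 : ContMDiffAt T.I P.G.toFMn.I ∞ (fun s => τ (k s • f s) * (τ (f s))⁻¹) t :=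
    ContMDiffAt.mul (G := P.G.toFMn) h2 (ContMDiffAt.inv (G := P.G.toFMn) h1)
  refine h3.congr_of_eventuallyEq ?_
  filter_upwards [hf.continuous.continuousAt.preimage_mem_nhds (hV.mem_nhds hxU)] with s hs
  rw [hg (f s) hs, mul_inv_cancel_right]

theorem contMDiff_smul_left (g : P.G.toFMn) : ContMDiff M.I M.I ∞ (fun x : M => g • x) :=
  P.contMDiff_act.comp (contMDiff_prodObj_mk contMDiff_const contMDiff_id)

theorem contMDiff_orbit (x : M) : ContMDiff P.G.toFMn.I M.I ∞ (fun g : P.G.toFMn => g • x) :=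
  P.contMDiff_act.comp (contMDiff_prodObj_mk contMDiff_id contMDiff_const)

/-- Orbit maps are immersions: `y ↦ τ y (τ x)⁻¹` is a left inverse of `g ↦ g • x`, smooth near the
orbit. -/
theorem eq_zero_of_diff_orbit {x : M} {g : P.G.toFMn} {v : TangentSpace P.G.toFMn.I g}
    (hv : diff (N := M) (fun g : P.G.toFMn => g • x) g v = 0) : v = 0 := by
  obtain ⟨U, τ, hU, hxU, hτ, hg, -⟩ := P.exists_division (fn π x)
  have hV : IsOpen (fn π ⁻¹' U) := hU.preimage (contMDiff_fn π).continuous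
  have hgx : fn π (g • x) ∈ U := by rw [fn_smul]; exact hxU
  have h2 : ContMDiffAt M.I P.G.toFMn.I ∞ (fun y => τ y * (τ x)⁻¹) (g • x) :=
    ContMDiffAt.mul (G := P.G.toFMn) (hτ.contMDiffAt (hV.mem_nhds hgx)) contMDiffAt_const
  refine injective_mfderiv_of_leftInverse (g := fun y => τ y * (τ x)⁻¹)
    ((P.contMDiff_orbit x g).mdifferentiableAt (by simp)) (h2.mdifferentiableAt (by simp)) ?_ hv
  intro g'
  rw [hg x hxU, mul_inv_cancel_right]

/-- The differential of the action map in terms of its partial differentials. -/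
theorem diff_smul_eq {T : FMn} {k : T → P.G.toFMn} {f : T → M} (hk : ContMDiff T.I P.G.toFMn.I ∞ k)
    (hf : ContMDiff T.I M.I ∞ f) (t : T) (v : TangentSpace T.I t) :
    diff (N := M) (fun s => k s • f s) t v =
      (show M.E from diff (N := M) (fun x : M => k t • x) (f t) (diff f t v)) +
        (show M.E from diff (N := M) (fun g : P.G.toFMn => g • f t) (k t) (diff k t v)) := by
  have e0 := diff_comp_apply P.contMDiff_act (contMDiff_prodObj_mk hk hf) t v
  have e1 := diff_comp_apply P.contMDiff_act (contMDiff_prodObj_mk (T := M) (X := P.G.toFMn)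
    (contMDiff_const (c := k t)) contMDiff_id) (f t) (diff f t v)
  have e2 := diff_comp_apply P.contMDiff_act (contMDiff_prodObj_mk (T := P.G.toFMn) (Y := M)
    contMDiff_id (contMDiff_const (c := f t))) (k t) (diff k t v)
  refine e0.trans (Eq.trans ?_ (congrArg₂ (fun a b : M.E => a + b) e1 e2).symm)
  refine Eq.trans ?_ (map_add (diff (N := M) (fun p : prodObj P.G.toFMn M => pfst p • psnd p)
    (pmk (k t) (f t))) _ _)
  -- Both partial differentials are the differential of the action applied to tangent vectors of `G
  -- × M`, of components `(0, df v)` and `(dk v, 0)`; it remains to see that these add up to `(dk v,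
  -- df v)`.
  congr 1
  refine prodObj_tangent_ext ?_ ?_
  · rw [map_add]
    rw [diff_fst_mk hk hf]
    refine Eq.trans (zero_add _).symm (congrArg₂ (fun a b : P.G.toFMn.E => a + b) ?_ ?_)
    · refine Eq.trans ?_ (diff_fst_mk (T := M) (X := P.G.toFMn)
        (contMDiff_const (c := k t)) contMDiff_id (f t) (diff f t v)).symm
      rw [diff_const]
      rfl
    · refine Eq.trans ?_ (diff_fst_mk (T := P.G.toFMn) (Y := M)
        contMDiff_id (contMDiff_const (c := f t)) (k t) (diff k t v)).symm
      exact congrArg (fun A => A (diff k t v)) (diff_id P.G.toFMn (k t)).symm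
  · rw [map_add]
    rw [diff_snd_mk hk hf]
    refine Eq.trans (add_zero _).symm (congrArg₂ (fun a b : M.E => a + b) ?_ ?_)
    · refine Eq.trans ?_ (diff_snd_mk (T := M) (X := P.G.toFMn)
        (contMDiff_const (c := k t)) contMDiff_id (f t) (diff f t v)).symm
      exact congrArg (fun A => A (diff f t v)) (diff_id M (f t)).symm
    · refine Eq.trans ?_ (diff_snd_mk (T := P.G.toFMn) (Y := M)
        contMDiff_id (contMDiff_const (c := f t)) (k t) (diff k t v)).symm
      rw [diff_const]
      rfl

/-- A smooth family of group elements that moves a direction of the foliation to a direction of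
the foliation is constant in that direction. -/
theorem diff_eq_zero_of_smul {T : FMn} {k : T → P.G.toFMn} {f : T → M}
    (hf : ContMDiff T.I M.I ∞ f) (hh : ContMDiff T.I M.I ∞ (fun t => k t • f t)) {t : T}
    {v : TangentSpace T.I t} (hfv : diff f t v ∈ M.fol.D (f t))
    (hhv : diff (N := M) (fun s => k s • f s) t v ∈ M.fol.D (k t • f t)) : diff k t v = 0 := by
  have hk := P.contMDiff_of_smul hf hh
  refine P.eq_zero_of_diff_orbit (x := f t) ?_
  -- Invariance makes the translated part of the product rule tangent to the foliation; subtracting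
  -- it, the part coming from `dk(v)` is tangent as well.
  have h1 : diff (N := M) (fun x : M => k t • x) (f t) (diff f t v) ∈ M.fol.D (k t • f t) :=
    (P.invariant (k t) (f t)).le (Submodule.mem_map_of_mem hfv)
  have h2 : diff (N := M) (fun g : P.G.toFMn => g • f t) (k t) (diff k t v) ∈
      M.fol.D (k t • f t) := by
    have h3 := Submodule.sub_mem _ hhv h1
    rw [P.diff_smul_eq hk hf] at h3
    have h4 : ∀ a b : M.E, (a + b) - a = b := fun a b => add_sub_cancel_left a b
    exact (congrArg (· ∈ M.fol.D (k t • f t)) (h4 _ _)).mp h3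
  -- The remaining vector is tangent to an orbit, hence killed by `dπ`, which is injective on the
  -- foliation.
  refine (P.connection (k t • f t)).injOn h2 (Submodule.zero_mem _) ?_
  rw [map_zero]
  refine (diff_comp_apply (contMDiff_fn π) (P.contMDiff_orbit (f t)) (k t) (diff k t v)).symm.trans
    ?_
  have : fn π ∘ (fun g : P.G.toFMn => g • f t) = fun _ => fn π (f t) :=
    funext fun g => P.fn_smul g (f t)
  rw [this, diff_const]
  rfl

end PrincipalStructure

/-! ### The action groupoid of a principal bundle -/

open scoped Topology in
theorem eq_of_mfderiv_eq_zero {E : Type*} [NormedAddCommGroup E] [NormedSpace ℝ E]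
    {H : Type*} [TopologicalSpace H] {I : ModelWithCorners ℝ E H} {M : Type*} [TopologicalSpace M]
    [ChartedSpace H M] [IsManifold I ∞ M] {f : ℝ → M} (hf : MDifferentiable 𝓘(ℝ, ℝ) I f)
    (h : ∀ t, mfderiv 𝓘(ℝ, ℝ) I f t = 0) (a b : ℝ) : f a = f b := by
  have : IsManifold I 1 M := IsManifold.of_le (n := ∞) (by exact_mod_cast le_top)
  refine IsLocallyConstant.apply_eq_of_isPreconnected ?_ isPreconnected_univ trivial trivial
  refine (IsLocallyConstant.iff_eventually_eq f).mpr fun t₀ => ?_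
  set ψ := extChartAt I (f t₀)
  have hs : IsOpen (f ⁻¹' ψ.source) := (isOpen_extChartAt_source (f t₀)).preimage hf.continuous
  have hψ : ∀ t ∈ f ⁻¹' ψ.source, MDifferentiableAt I 𝓘(ℝ, E) ψ (f t) := fun t ht =>
    mdifferentiableAt_extChartAt (by rwa [Set.mem_preimage, extChartAt_source] at ht)
  have h1 := hs.isOpen_inter_preimage_of_fderiv_eq_zero (f := ψ ∘ f) (𝕜 := ℝ)
    (fun t ht => ((hψ t ht).comp t (hf t)).differentiableAt.differentiableWithinAt)
    (fun t ht => by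
      rw [← mfderiv_eq_fderiv, mfderiv_comp t (hψ t ht) (hf t), h]
      exact ContinuousLinearMap.comp_zero _) {ψ (f t₀)}
  have h0 : f t₀ ∈ ψ.source := mem_extChartAt_source (f t₀)
  filter_upwards [h1.mem_nhds ⟨h0, rfl⟩] with t ht
  exact ψ.injOn ht.1 h0 ht.2

namespace FMn

/-- A morphism to a manifold foliated by points is constant along the leaves. -/
theorem fn_eq_of_mem_leaf {M N : FMn} (hN : N.fol.rank = 0) (k : M ⟶ N) {p q : M}
    (hq : q ∈ M.fol.leaf p) : fn k q = fn k p := by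
  obtain ⟨γ, hγ, hd, rfl, rfl⟩ := hq
  have hk : MDifferentiable M.I N.I (fn k) := (contMDiff_fn k).mdifferentiable (by simp)
  have hγ' : MDifferentiable 𝓘(ℝ, ℝ) M.I γ := hγ.mdifferentiable (by simp)
  refine eq_of_mfderiv_eq_zero (I := N.I) (f := fn k ∘ γ) (hk.comp hγ') (fun t => ?_) 1 0
  rw [mfderiv_comp t (hk _) (hγ' t)]
  refine ContinuousLinearMap.ext_ring ?_
  exact diff_fn_eq_zero hN k (hd t)

/-- This is where the density of a leaf enters: two continuous maps to a Hausdorff space that agree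
on a dense set are equal. -/
theorem fn_eq_const {M N : FMn} (hN : N.fol.rank = 0) (k : M ⟶ N) {p : M}
    (hp : Dense (M.fol.leaf p)) (x : M) : fn k x = fn k p := by
  have h := Continuous.ext_on hp (contMDiff_fn k).continuous (continuous_const (y := fn k p))
    fun q hq => fn_eq_of_mem_leaf hN k hq
  exact congrFun h x

end FMn

namespace PrincipalStructure

open FMn

variable {M B : FMn} {π : M ⟶ B} (P : PrincipalStructure π)

/-- The division of two morphisms with the same projection. -/
theorem exists_hom_smul_eq {T : FMn} {f h : T ⟶ M} (e : f ≫ π = h ≫ π) :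
    ∃ k : T ⟶ P.G.toFMn, ∀ t, fn k t • fn f t = fn h t := by
  have h1 : ∀ t, ∃ g : P.G.toFMn, g • fn f t = fn h t := fun t =>
    P.exists_smul_eq (congrArg (fun k => fn k t) e)
  choose k hk using h1
  have hh : ContMDiff T.I M.I ∞ (fun t => k t • fn f t) := by
    rw [funext hk]
    exact contMDiff_fn h
  refine ⟨mkHomDiscrete (by rfl) k (P.contMDiff_of_smul (contMDiff_fn f) hh) fun t v hv => ?_, hk⟩
  refine P.diff_eq_zero_of_smul (contMDiff_fn f) hh (diff_fn_mem f hv) ?_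
  -- Stated for a variable map so that the base point, on which the fibre depends, can be rewritten.
  have : ∀ h' : T → M, h' = fn h → diff h' t v ∈ M.fol.D (h' t) := by
    rintro _ rfl
    exact diff_fn_mem h hv
  exact this _ (funext hk)

/-- The action map, as a morphism. -/
noncomputable def actHom : prodObj P.G.toFMn M ⟶ M :=
  mkHom (fun p => pfst p • psnd p) P.contMDiff_act
    (fun p v hv => by
      obtain ⟨h1, h2⟩ := mem_prodObj_D.mp hv
      rw [D_eq_bot (by rfl), Submodule.mem_bot] at h1
      rw [P.diff_smul_eq (contMDiff_prodObj_fst _ _) (contMDiff_prodObj_snd _ _), h1, map_zero]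
      exact (congrArg (· ∈ M.fol.D (pfst p • psnd p)) (add_zero (M := M.E) _)).mpr
        ((P.invariant (pfst p) (psnd p)).le (Submodule.mem_map_of_mem h2)))
    (fun p w hw => by
      obtain ⟨u, hu, huw⟩ := (P.invariant (pfst p) (psnd p)).ge hw
      obtain ⟨v, hv1, hv2⟩ := exists_diff_fst_snd p 0 u
      refine ⟨v, mem_prodObj_D.mpr ⟨by rw [hv1]; exact Submodule.zero_mem _, by rwa [hv2]⟩, ?_⟩
      rw [P.diff_smul_eq (contMDiff_prodObj_fst _ _) (contMDiff_prodObj_snd _ _), hv1, hv2,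
        map_zero]
      exact (add_zero (M := M.E) _).trans huw)

/-- The action of a principal bundle, as an action of a group object. -/
noncomputable def groupObjectAction : GroupObjectAction P.G.toGroupObject M where
  prod := prodObj P.G.toFMn M
  fst := prodFst (by rfl) M
  snd := prodSnd _ M
  isLimit := prodIsLimit (by rfl) M
  act := P.actHom
  one_act x := hom_ext fun t => one_smul P.G.toFMn (fn x t)
  mul_act g h x := hom_ext fun t => mul_smul (fn g t : P.G.toFMn) (fn h t : P.G.toFMn) (fn x t)

/-- Division of morphisms provides the lift to `G × M`; freeness of the action makes it unique. -/
theorem isKernelPair : IsKernelPair π P.groupObjectAction.snd P.groupObjectAction.act := by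
  refine ⟨⟨hom_ext fun p => (P.fn_smul (pfst p) (psnd p)).symm⟩, ⟨PullbackCone.IsLimit.mk _
    (fun c => prodLift (by rfl) (P.exists_hom_smul_eq c.condition).choose c.fst) ?_ ?_ ?_⟩⟩
  · intro c
    rfl
  · intro c
    exact hom_ext (P.exists_hom_smul_eq c.condition).choose_spec
  · intro c m h1 h2
    have h1' : ∀ t, psnd (fn m t) = fn c.fst t := fun t => congrArg (fun k => fn k t) h1
    refine hom_ext fun t => Prod.ext (P.smul_right_cancel (x := fn c.fst t) ?_) (h1' t)
    refine Eq.trans ?_ ((P.exists_hom_smul_eq c.condition).choose_spec t).symm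
    refine Eq.trans ?_ (congrArg (fun k => fn k t) h2)
    exact congrArg (pfst (fn m t) • ·) (h1' t).symm

/-- The translation by an element of the group. -/
noncomputable def smulHom (g : P.G.toFMn) : M ⟶ M :=
  mkHom (fun x => g • x) (P.contMDiff_smul_left g)
    (fun p _ hv => (P.invariant g p).le (Submodule.mem_map_of_mem hv))
    (fun p _ hw => (P.invariant g p).ge hw)

/-- The automorphisms of a principal bundle given by its structure group. -/
noncomputable def toAutOver : P.G.toFMn →* AutOver π where
  toFun g := ⟨⟨P.smulHom g, P.smulHom g⁻¹, hom_ext fun x => inv_smul_smul g x,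
    hom_ext fun x => smul_inv_smul g x⟩, hom_ext fun x => P.fn_smul g x⟩
  map_one' := Subtype.ext (Iso.ext (hom_ext fun x => one_smul _ x))
  map_mul' g h := Subtype.ext (Iso.ext (hom_ext fun x => mul_smul g h x))

theorem fn_toAutOver (g : P.G.toFMn) (x : M) : fn (P.toAutOver g : Aut M).hom x = g • x := rfl

/-- An automorphism over `B` is the quotient of the identity by a morphism `M ⟶ G`. That morphism is
constant because `G` has rank zero and `M` has a dense leaf, so the automorphism is a translation.
-/
theorem bijective_toAutOver (hM : M.Irreducible) : Function.Bijective P.toAutOver := by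
  obtain ⟨p, hp⟩ := hM
  constructor
  · intro g h e
    refine P.smul_right_cancel (x := p) ?_
    rw [← P.fn_toAutOver, e, P.fn_toAutOver]
  · intro σ
    have hσ : (σ : Aut M).hom ≫ π = π := σ.2
    obtain ⟨k, hk⟩ := P.exists_hom_smul_eq (f := 𝟙 M) (h := (σ : Aut M).hom)
      ((Category.id_comp π).trans hσ.symm)
    refine ⟨fn k p, Subtype.ext (Iso.ext (hom_ext fun x => ?_))⟩
    rw [P.fn_toAutOver, ← fn_eq_const (by rfl) k hp x]
    exact hk x

/-- The structure group of a principal bundle over an irreducible manifold is the group of its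
automorphisms over the base. -/
noncomputable def autOverEquiv (hM : M.Irreducible) : P.G.toFMn ≃* AutOver π :=
  MulEquiv.ofBijective P.toAutOver (P.bijective_toAutOver hM)

theorem fn_autOverEquiv (hM : M.Irreducible) (g : P.G.toFMn) (x : M) :
    fn (P.autOverEquiv hM g : Aut M).hom x = g • x := rfl

/-- Principal structures are unique. -/
theorem isomorphic (hM : M.Irreducible) (P Q : PrincipalStructure π) : P.Isomorphic Q := by
  obtain ⟨p, -⟩ := id hM
  have h : ∀ P Q : PrincipalStructure π, ∀ (g : P.G.toFMn) (x : M),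
      (Q.autOverEquiv hM).symm (P.autOverEquiv hM g) • x = g • x := fun P Q g x => by
    rw [← Q.fn_autOverEquiv hM, MulEquiv.apply_symm_apply, P.fn_autOverEquiv hM]
  have hs : ∀ P Q : PrincipalStructure π, ContMDiff P.G.toFMn.I Q.G.toFMn.I ∞
      (fun g : P.G.toFMn => (Q.autOverEquiv hM).symm (P.autOverEquiv hM g)) := fun P Q => by
    -- The abstract isomorphism sends `g` to the element of `Q.G` moving `p` to `g • p`. It is
    -- smooth by division, since the orbit map of `P` is.
    refine Q.contMDiff_of_smul (T := P.G.toFMn) (f := fun _ => p) contMDiff_const ?_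
    rw [funext fun g => h P Q g p]
    exact P.contMDiff_orbit p
  exact ⟨(P.autOverEquiv hM).trans (Q.autOverEquiv hM).symm, hs P Q, hs Q P, fun g x =>
    (h P Q g x).symm⟩

end PrincipalStructure

/-! ### Group objects of foliated manifolds are Lie groups -/

/-- The point of the one-point manifold. -/
def FMn.unit : FMn.point := PUnit.unit

namespace GroupObject

open FMn

variable (G : GroupObject FMn)

/-- The unit maps the zero tangent space of the point onto the foliation at the unit element, and
the rank is constant. -/
theorem rank_eq_zero : G.X.fol.rank = 0 := by
  have h := map_fol_fn (1 : point ⟶ G.X) unit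
  rw [D_eq_bot (X := point) (by rfl), Submodule.map_bot] at h
  have h1 := G.X.fol.finrank_eq (fn (1 : point ⟶ G.X) unit)
  rw [← h, finrank_bot] at h1
  exact h1.symm

/-- The point `g` of `G`. -/
noncomputable def pointHom (g : G.X) : point ⟶ G.X :=
  homOfRankZero (by rfl) G.rank_eq_zero (fun _ => g) contMDiff_const

/-- The constant morphism with value `g`. -/
noncomputable def const (T : FMn) (g : G.X) : T ⟶ G.X :=
  pointIsTerminal.from T ≫ G.pointHom g

theorem fn_pointHom (g : G.X) (t : point) : fn (G.pointHom g) t = g := rfl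

/-- The multiplication of a group object. -/
noncomputable def mulHom : prodObj G.X G.X ⟶ G.X := prodFst G.rank_eq_zero G.X * prodSnd G.X G.X

noncomputable instance : Mul G.X := ⟨fun x y => fn G.mulHom (pmk x y)⟩

noncomputable instance : One G.X := ⟨fn (1 : point ⟶ G.X) unit⟩

noncomputable instance : Inv G.X := ⟨fn (𝟙 G.X)⁻¹⟩

variable {G}

/-- By naturality every product `a * b` factors through the product of the two projections of `G ×
G`, so multiplication of generalized elements is pointwise. -/
theorem fn_mul {T : FMn} (a b : T ⟶ G.X) (t : T) : fn (a * b) t = fn a t * fn b t := by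
  have h : prodLift G.rank_eq_zero a b ≫ G.mulHom = a * b := by
    unfold mulHom
    rw [G.comp_mul]
    rfl
  rw [← h]
  rfl

theorem fn_one (T : FMn) (t : T) : fn (1 : T ⟶ G.X) t = 1 := by
  rw [← G.comp_one (pointIsTerminal.from T)]
  rfl

theorem fn_inv {T : FMn} (a : T ⟶ G.X) (t : T) : fn a⁻¹ t = (fn a t)⁻¹ := by
  have h := G.comp_inv a (𝟙 G.X)
  rw [Category.comp_id] at h
  rw [← h]
  rfl

/-- Because `G` has rank zero, each of its points is a morphism from `⋆`, and the group laws can be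
read in `Hom(⋆, G)`. -/
noncomputable instance : Group G.X where
  mul_assoc x y z := by
    have h := congrArg (fun k => fn k unit) (mul_assoc (G.pointHom x) (G.pointHom y) (G.pointHom z))
    simpa only [fn_mul, fn_pointHom] using h
  one_mul x := by
    have h := congrArg (fun k => fn k unit) (one_mul (G.pointHom x))
    simpa only [fn_mul, fn_pointHom, fn_one] using h
  mul_one x := by
    have h := congrArg (fun k => fn k unit) (mul_one (G.pointHom x))
    simpa only [fn_mul, fn_pointHom, fn_one] using h
  inv_mul_cancel x := by
    have h := congrArg (fun k => fn k unit) (inv_mul_cancel (G.pointHom x))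
    simpa only [fn_mul, fn_pointHom, fn_one, fn_inv] using h

variable (G)

instance : LieGroup G.X.I ∞ G.X where
  contMDiff_mul := contMDiff_fn G.mulHom
  contMDiff_inv := contMDiff_fn (𝟙 G.X)⁻¹

/-- The Lie group given by a group object. -/
noncomputable def toRealLieGroup : RealLieGroup where
  E := G.X.E
  H := G.X.H
  I := G.X.I
  carrier := G.X

end GroupObject

/-! ### Splitting actions give principal bundles -/

namespace GroupObjectAction

open FMn
open scoped Topology

variable {G : GroupObject FMn} {M B : FMn} {π : M ⟶ B} (α : GroupObjectAction G M)

/-- The action map on the product manifold. -/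
noncomputable def actMap : prodObj G.X M ⟶ M :=
  α.smul (prodFst G.rank_eq_zero M) (prodSnd G.X M)

/-- The action on points. -/
noncomputable def pointSMul (g : G.X) (x : M) : M := fn α.actMap (pmk g x)

theorem fn_smul {T : FMn} (g : T ⟶ G.X) (x : T ⟶ M) (t : T) :
    fn (α.smul g x) t = α.pointSMul (fn g t) (fn x t) :=
  (congrArg (fun k => fn k t)
    (α.comp_smul (prodLift G.rank_eq_zero g x) (prodFst G.rank_eq_zero M) (prodSnd G.X M))).symm

theorem fn_smul_const (g : G.X) (x : M) :
    fn (α.smul (G.const M g) (𝟙 M)) x = α.pointSMul g x := α.fn_smul _ _ x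

/-- The action of the points of the group object. -/
noncomputable abbrev mulAction : MulAction G.X M where
  smul := α.pointSMul
  one_smul x := by
    -- A point of `M` need not be a morphism from `⋆`. The laws are applied to the generalized
    -- element `𝟙 M`, with constant morphisms to `G`, and evaluated at `x`.
    have h := congrArg (fun k => fn k x) (α.one_smul' (𝟙 M))
    refine Eq.trans ?_ h
    refine Eq.trans ?_ (α.fn_smul _ _ _).symm
    rw [GroupObject.fn_one]
    rfl
  mul_smul g h x := by
    have e := congrArg (fun k => fn k x) (α.mul_smul' (G.const M g) (G.const M h) (𝟙 M))
    refine Eq.trans ?_ (e.trans ?_)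
    · refine Eq.trans ?_ (α.fn_smul _ _ _).symm
      rw [GroupObject.fn_mul]
      rfl
    · exact (α.fn_smul _ _ _).trans (congrArg (α.pointSMul g) (α.fn_smul _ _ _))

variable {α}

theorem smul_comp (hα : IsKernelPair π α.snd α.act) {T : FMn} (g : T ⟶ G.X) (x : T ⟶ M) : α.smul g x ≫ π = x ≫ π := by
  unfold smul
  rw [Category.assoc, ← hα.w, ← Category.assoc, α.pair_snd]

theorem fn_pointSMul (hα : IsKernelPair π α.snd α.act) (g : G.X) (x : M) : fn π (α.pointSMul g x) = fn π x :=
  (congrArg (fn π) (α.fn_smul_const g x)).symm.trans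
    (congrArg (fun k => fn k x) (smul_comp hα (G.const M g) (𝟙 M)))

/-- Transitivity on generalized elements: the universal property of the kernel pair, followed by the
projection to `G`. The uniqueness half of that property gives freeness, `hom_eq_of_smul_eq`. -/
theorem exists_hom_of_comp_eq (hα : IsKernelPair π α.snd α.act) {T : FMn} {f h : T ⟶ M} (e : f ≫ π = h ≫ π) :
    ∃ k : T ⟶ G.X, α.smul k f = h := by
  refine ⟨hα.lift f h e ≫ α.fst, ?_⟩
  have h1 := α.comp_act (hα.lift f h e)
  rw [hα.lift_snd, hα.lift_fst] at h1
  exact h1.symm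

theorem hom_eq_of_smul_eq (hα : IsKernelPair π α.snd α.act) {T : FMn} {k k' : T ⟶ G.X} {f : T ⟶ M}
    (e : α.smul k f = α.smul k' f) : k = k' := by
  have h : α.pair k f = α.pair k' f := hα.hom_ext (by simp) e
  rw [← α.pair_fst k f, h, α.pair_fst]

/-- Smooth division in the fibres. -/
theorem exists_local_division (hα : IsKernelPair π α.snd α.act)
    (hπ : Manifold.IsSubmersion M.I B.I ∞ (fn π))
    (hconn : IsPartialConnection π) {x₀ y₀ : M} (h₀ : fn π x₀ = fn π y₀) :
    ∃ (N : Set (M × M)) (δ : M × M → G.X), IsOpen N ∧ (x₀, y₀) ∈ N ∧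
      ContMDiffOn (M.I.prod M.I) G.X.I ∞ δ N ∧
      ∀ x y, (x, y) ∈ N → fn π x = fn π y → α.pointSMul (δ (x, y)) x = y ∧
        ∀ g, α.pointSMul g x = y → g = δ (x, y) := by
  obtain ⟨T, p, q, N, l, hpq, hN, h0N, hl, hlN, hW⟩ := exists_local_kernel_pair π hπ hconn h₀
  -- The two projections of the local model of `M ×_B M` are divided by a morphism `κ`; composed
  -- with the coordinates `l` it becomes the smooth division map.
  obtain ⟨κ, hκ⟩ := exists_hom_of_comp_eq hα hpq
  have hκ' : ∀ t, α.pointSMul (fn κ t) (fn p t) = fn q t := fun t =>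
    (α.fn_smul κ p t).symm.trans (congrArg (fun k => fn k t) hκ)
  have hδ : ∀ x y, (x, y) ∈ N → fn π x = fn π y → α.pointSMul (fn κ (l (x, y))) x = y := by
    intro x y hxy e
    obtain ⟨h1, h2⟩ := hlN x y hxy e
    have := hκ' (l (x, y))
    rwa [h1, h2] at this
  refine ⟨N, fun z => fn κ (l z), hN, h0N, (contMDiff_fn κ).comp_contMDiffOn hl,
    fun x y hxy e => ⟨hδ x y hxy e, ?_⟩⟩
  rintro g rfl
  -- For uniqueness, the pair `(g, x)` need not be a generalized element, so it is replaced by a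
  -- foliated chart `W` around it in `G × M`, small enough for `(x', g' • x')` to remain in `N`.
  have hO : {p : prodObj G.X M | (psnd p, fn α.actMap p) ∈ N} ∈ 𝓝 (pmk g x) := by
    refine (hN.preimage ?_).mem_nhds hxy
    exact (contMDiff_prodObj_snd G.X M).continuous.prodMk (contMDiff_fn α.actMap).continuous
  obtain ⟨W, j, w₀, hw₀, hj⟩ := exists_local_object _ _ hO
  have hc : α.smul (j ≫ prodFst G.rank_eq_zero M) (j ≫ prodSnd G.X M) = j ≫ α.actMap :=
    (α.comp_smul _ _ _).symm
  obtain ⟨k, hk⟩ := hW W (j ≫ prodSnd G.X M) (j ≫ α.actMap)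
    (by rw [← hc, smul_comp hα]) hj
  -- Both morphisms `W ⟶ G` carry the `M`-component to its image under the action, so they agree by
  -- freeness on generalized elements. Evaluating at `w₀` gives the claim for `g`.
  have h1 : k ≫ κ = j ≫ prodFst G.rank_eq_zero M := by
    refine hom_eq_of_smul_eq hα (f := j ≫ prodSnd G.X M) (hom_ext fun w => ?_)
    rw [hc, α.fn_smul, comp_fn, hk]
    refine hδ _ _ (hj w) ?_
    refine congrArg (fun k => fn k w) (?_ : (j ≫ prodSnd G.X M) ≫ π = (j ≫ α.actMap) ≫ π)
    rw [← hc, smul_comp hα]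
  have h2 := congrArg (fun k => fn k w₀) h1
  have h3 : ∀ z, z = pmk g x → fn κ (l (psnd z, fn α.actMap z)) = pfst z →
      g = fn κ (l (x, α.pointSMul g x)) := by
    rintro _ rfl h
    exact h.symm
  refine h3 _ hw₀ (Eq.trans ?_ h2)
  exact congrArg (fn κ) (hk w₀).symm

/-- A splitting action makes a surjective submersion a principal bundle. -/
theorem isPrincipalBundle (hα : IsKernelPair π α.snd α.act)
    (hsurj : Function.Surjective (fn π))
    (hπ : Manifold.IsSubmersion M.I B.I ∞ (fn π)) (hconn : IsPartialConnection π) :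
    letI : MulAction G.toRealLieGroup M := α.mulAction
    IsPrincipalBundle π G.toRealLieGroup := by
  let _ : MulAction G.X M := α.mulAction
  let _ : MulAction G.toRealLieGroup M := α.mulAction
  have hfn : ∀ (g : G.X) (x : M), fn π (g • x) = fn π x := fn_pointSMul hα
  have htrans : ∀ x y : M, fn π x = fn π y → ∃ g : G.X, g • x = y := fun x y h => by
    obtain ⟨N, δ, -, hxy, -, h1⟩ := exists_local_division hα hπ hconn h
    exact ⟨_, (h1 x y hxy h).1⟩
  have hfree : ∀ (g h : G.X) (x : M), g • x = h • x → g = h := fun g h x e => by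
    have h0 : fn π x = fn π (h • x) := (hfn h x).symm
    obtain ⟨N, δ, -, hxy, -, h1⟩ := exists_local_division hα hπ hconn h0
    exact ((h1 _ _ hxy h0).2 g e).trans ((h1 _ _ hxy h0).2 h rfl).symm
  have hsm : ContMDiff (G.X.I.prod M.I) M.I ∞ (fun p : G.X × M => p.1 • p.2) :=
    contMDiff_fn α.actMap
  refine ⟨⟨hsm⟩, fun b => ?_⟩
  obtain ⟨y₀, rfl⟩ := hsurj b
  -- The trivialization over `U` is the inverse of `(b, g) ↦ g • s b`, for a local section `s`; its
  -- group component is `τ`.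
  obtain ⟨U, s, hU, hbU, hs, hsy, hsU⟩ := exists_local_section hπ y₀
  have hτ : ∀ x : M, ∃ g : G.X, fn π x ∈ U → g • s (fn π x) = x := fun x => by
    by_cases hx : fn π x ∈ U
    · obtain ⟨g, hg⟩ := htrans (s (fn π x)) x (hsU _ hx)
      exact ⟨g, fun _ => hg⟩
    -- The value off the preimage of `U` is irrelevant.
    · exact ⟨1, fun h => absurd h hx⟩
  choose τ hτ using hτ
  have hV : IsOpen (fn π ⁻¹' U) := hU.preimage (contMDiff_fn π).continuous
  have hsπ : ContMDiffOn M.I M.I ∞ (fun x => s (fn π x)) (fn π ⁻¹' U) :=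
    hs.comp (contMDiff_fn π).contMDiffOn fun x hx => hx
  have hτs : ContMDiffOn M.I G.X.I ∞ τ (fn π ⁻¹' U) := by
    intro x₁ hx₁
    -- Near `x₁`, uniqueness of division gives `τ x = δ (s (π x), x)`, which is smooth although `τ`
    -- was chosen pointwise.
    obtain ⟨N, δ, hN, hxN, hδ, h1⟩ := exists_local_division hα hπ hconn (hsU _ hx₁)
    have hc : ContMDiffAt M.I (M.I.prod M.I) ∞ (fun x => (s (fn π x), x)) x₁ :=
      (hsπ.contMDiffAt (hV.mem_nhds hx₁)).prodMk contMDiffAt_id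
    refine ContMDiffAt.contMDiffWithinAt ?_
    refine (ContMDiffAt.comp x₁ (f := fun x => (s (fn π x), x))
      (hδ.contMDiffAt (hN.mem_nhds hxN)) hc).congr_of_eventuallyEq ?_
    filter_upwards [hc.continuousAt.preimage_mem_nhds (hN.mem_nhds hxN), hV.mem_nhds hx₁]
      with x hx hxU
    exact (h1 _ _ hx (hsU _ hxU)).2 _ (hτ x hxU)
  have hinv : ∀ z : B × G.X, z.1 ∈ U → fn π (z.2 • s z.1) = z.1 := fun z hz => by
    rw [hfn, hsU _ hz]
  let Φ : PartialDiffeomorph M.I (B.I.prod G.X.I) M (B × G.X) ∞ :=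
    { toFun := fun x => (fn π x, τ x)
      invFun := fun z => z.2 • s z.1
      source := fn π ⁻¹' U
      target := U ×ˢ Set.univ
      map_source' := fun x hx => ⟨hx, trivial⟩
      map_target' := fun z hz => by
        rw [Set.mem_preimage, hinv z hz.1]
        exact hz.1
      left_inv' := fun x hx => hτ x hx
      right_inv' := fun z hz => by
        have h1 := hinv z hz.1
        refine Prod.ext h1 (hfree _ _ (s z.1) ?_)
        have h2 := hτ (z.2 • s z.1) (h1.symm ▸ hz.1)
        rwa [h1] at h2
      open_source := hV
      open_target := hU.prod isOpen_univ
      contMDiffOn_toFun := (contMDiff_fn π).contMDiffOn.prodMk hτs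
      contMDiffOn_invFun := hsm.comp_contMDiffOn (contMDiffOn_snd.prodMk
        (hs.comp contMDiffOn_fst fun z hz => hz.1)) }
  refine ⟨U, hU, hbU, Φ, rfl, rfl, fun x hx => ⟨rfl, fun g => ?_⟩⟩
  have h1 : fn π (g • x) = fn π x := hfn g x
  have h2 : fn π (g • x) ∈ U := h1.symm ▸ hx
  refine ⟨h2, Prod.ext h1 (hfree _ _ (s (fn π x)) ?_)⟩
  have h3 := hτ _ h2
  replace h3 : τ (g • x) • s (fn π x) = g • x := (congrArg (fun b => τ (g • x) • s b) h1).symm.trans h3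
  exact h3.trans ((congrArg (fun y : M => g • y) (hτ x hx).symm).trans
    (mul_smul (g : G.X) (τ x) (s (fn π x))).symm)

/-- The principal structure given by a splitting action. -/
noncomputable def toPrincipalStructure (hα : IsKernelPair π α.snd α.act)
    (hsurj : Function.Surjective (fn π))
    (hπ : Manifold.IsSubmersion M.I B.I ∞ (fn π)) (hrank : M.fol.rank = B.fol.rank) :
    PrincipalStructure π :=
  letI : MulAction G.toRealLieGroup M := α.mulAction
  { G := G.toRealLieGroup
    principal := isPrincipalBundle hα hsurj hπ (isPartialConnection_of_rank π hrank)
    connection := isPartialConnection_of_rank π hrank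
    invariant := fun g p => by
      -- Translation by a point of `G` is a morphism of `FMn`, so invariance of the foliation is
      -- part of being a morphism.
      have h := map_fol_fn (α.smul (G.const M g) (𝟙 M)) p
      have h1 : fn (α.smul (G.const M g) (𝟙 M)) = fun x : M => g • x :=
        funext (α.fn_smul_const g)
      rw [h1] at h
      exact h }

end GroupObjectAction

/-! ### Galois structures -/

namespace PrincipalStructure

open FMn

variable {M B : FMn} {π : M ⟶ B} (P : PrincipalStructure π)

/-- The translations by `G` are automorphisms over `B` and already act transitively on the fibres,
so an invariant morphism descends as a map. The descended map is smooth by local sections, and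
respects the foliations because `dπ` maps `F` onto `D`. -/
theorem isNormalEpimorphism (P : PrincipalStructure π) (hsurj : Function.Surjective (fn π))
    (hπ : Manifold.IsSubmersion M.I B.I ∞ (fn π)) : IsNormalEpimorphism π := by
  refine ⟨fun σ => σ.2, fun Z f hf => ?_⟩
  have hinv : ∀ x y, fn π x = fn π y → fn f x = fn f y := fun x y h => by
    obtain ⟨g, rfl⟩ := P.exists_smul_eq h
    exact (congrArg (fun k => fn k x) (hf (P.toAutOver g))).symm
  obtain ⟨r, hr⟩ := hsurj.hasRightInverse
  have hπf : ∀ x, fn f (r (fn π x)) = fn f x := fun x => hinv _ _ (hr _)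
  have hs : ContMDiff B.I Z.I ∞ (fun b => fn f (r b)) := by
    intro b
    obtain ⟨y, rfl⟩ := hsurj b
    obtain ⟨U, s, hU, hbU, hs, -, hsU⟩ := exists_local_section hπ y
    have h1 := ((contMDiff_fn f).comp_contMDiffOn hs).contMDiffAt (hU.mem_nhds hbU)
    refine h1.congr_of_eventuallyEq ?_
    -- The section `r` is only set-theoretic, but `f ∘ r` agrees on `U` with `f ∘ s`, since `f` is
    -- constant on fibres.
    filter_upwards [hU.mem_nhds hbU] with b hb
    exact hinv _ _ ((hr b).trans (hsU b hb).symm)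
  have hd : ∀ (x : M) (v : TangentSpace M.I x),
      diff (fun b => fn f (r b)) (fn π x) (diff (fn π) x v) =
        (show Z.E from diff (fn f) x v) := fun x v => by
    refine (diff_comp_apply hs (contMDiff_fn π) x v).symm.trans ?_
    have h1 : (fun b => fn f (r b)) ∘ fn π = fn f := funext hπf
    rw [h1]
  have hmem : ∀ (x : M) (z : Z), z = fn f x → ∀ w : Z.E, w ∈ Z.fol.D z ↔ w ∈ Z.fol.D (fn f x) := by
    rintro x _ rfl w
    rfl
  refine ⟨mkHom (fun b => fn f (r b)) hs (fun b w hw => ?_) (fun b w hw => ?_),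
    hom_ext hπf, fun f' hf' => hom_ext fun b => ?_⟩
  · obtain ⟨x, rfl⟩ := hsurj b
    obtain ⟨v, hv, rfl⟩ := exists_diff_fn_eq π hw
    refine (hmem x _ (hπf x) _).mpr ?_
    rw [hd]
    exact diff_fn_mem f hv
  · obtain ⟨x, rfl⟩ := hsurj b
    obtain ⟨v, hv, hvw⟩ := exists_diff_fn_eq f ((hmem x _ (hπf x) _).mp hw)
    exact ⟨diff (fn π) x v, diff_fn_mem π hv, (hd x v).trans hvw⟩
  · have h1 : fn f' (fn π (r b)) = fn f (r b) := congrArg (fun k => fn k (r b)) hf'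
    rwa [hr b] at h1

/-- The points of the group object given by a Lie group. -/
noncomputable def pointsEquiv (G : RealLieGroup) :
    (point ⟶ G.toGroupObject.X) ≃* G.toFMn where
  toFun f := fn f unit
  invFun g := G.toGroupObject.pointHom g
  left_inv f := hom_ext fun _ => congrArg (fn f) (Subsingleton.elim (α := PUnit) _ _)
  right_inv _ := rfl
  map_mul' _ _ := rfl

theorem isGaloisStructure (hM : M.Irreducible) :
    IsGaloisStructure pointIsTerminal π P.groupObjectAction := by
  refine ⟨⟨_, _, _, P.isKernelPair,
    GroupObjectAction.isSplitting_of_isKernelPair P.isKernelPair⟩,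
    (pointsEquiv P.G).trans (P.autOverEquiv hM), fun g => hom_ext fun x => ?_⟩
  exact congrArg (fun t => (fn g t : P.G.toFMn) • x) (Subsingleton.elim (α := PUnit) _ _)

end PrincipalStructure

namespace GroupObjectAction

open FMn

variable {M B : FMn} {π : M ⟶ B} {G H : GroupObject FMn}

/-- Both actions are principal structures on `π`, so uniqueness of these gives an isomorphism of Lie
groups; between manifolds of rank zero, smooth maps are morphisms. -/
theorem isomorphic_of_isKernelPair (hM : M.Irreducible) (hsurj : Function.Surjective (fn π))
    (hπ : Manifold.IsSubmersion M.I B.I ∞ (fn π)) (hrank : M.fol.rank = B.fol.rank)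
    {α : GroupObjectAction G M} {β : GroupObjectAction H M}
    (hα : IsKernelPair π α.snd α.act) (hβ : IsKernelPair π β.snd β.act) : α.Isomorphic β := by
  obtain ⟨φ, h1, h2, h3⟩ := (toPrincipalStructure hα hsurj hπ hrank).isomorphic hM
    (toPrincipalStructure hβ hsurj hπ hrank)
  let φ' : G.X ≃* H.X := φ
  have h3' : ∀ g x, α.pointSMul g x = β.pointSMul (φ' g) x := h3
  let f : G.X ⟶ H.X := homOfRankZero G.rank_eq_zero H.rank_eq_zero φ' h1
  refine ⟨⟨f, homOfRankZero H.rank_eq_zero G.rank_eq_zero φ'.symm h2,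
    hom_ext φ'.symm_apply_apply, hom_ext φ'.apply_symm_apply⟩, fun a b => hom_ext fun t => ?_,
    fun g x => hom_ext fun t => ?_⟩
  · refine (congrArg φ' (GroupObject.fn_mul a b t)).trans ((map_mul φ' _ _).trans ?_)
    exact (GroupObject.fn_mul (a ≫ f) (b ≫ f) t).symm
  · rw [fn_smul, fn_smul]
    exact h3' _ _

end GroupObjectAction

/-- Uniqueness of the Galois structure uses only that both are splitting actions; the identification
of their points with the automorphism group is not needed for it. -/
theorem PrincipalStructure.isGaloisEpimorphism {M B : FMn} {π : M ⟶ B}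
    (P : PrincipalStructure π) (hM : M.Irreducible) (hsurj : Function.Surjective (FMn.fn π))
    (hπ : Manifold.IsSubmersion M.I B.I ∞ (FMn.fn π)) (hrank : M.fol.rank = B.fol.rank) :
    IsGaloisEpimorphism FMn.pointIsTerminal π := by
  refine ⟨P.isNormalEpimorphism hsurj hπ, ⟨_, _, P.isGaloisStructure hM⟩, ?_⟩
  rintro G H α β ⟨⟨_, _, _, _, hα⟩, -⟩ ⟨⟨_, _, _, _, hβ⟩, -⟩
  exact GroupObjectAction.isomorphic_of_isKernelPair hM hsurj hπ hrank
    (GroupObjectAction.isKernelPair_of_isSplitting hα)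
    (GroupObjectAction.isKernelPair_of_isSplitting hβ)

/-! ### The equivalences -/

theorem mainTheorem1 {M B : FMn} (π : M ⟶ B)
    (hsurj : Function.Surjective (FMn.fn π))
    (hsubm : Manifold.IsSubmersion M.I B.I ∞ (FMn.fn π))
    (hM : M.Irreducible) (hB : B.Irreducible)
    (hrank : M.fol.rank = B.fol.rank) :
    List.TFAE [
      KernelPairSplits π,
      IsGaloisEpimorphism FMn.pointIsTerminal π,
      Nonempty (PrincipalStructure π),
      Nonempty (PrincipalStructure π) ∧ ∀ P Q : PrincipalStructure π, P.Isomorphic Q] ∧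
    ∀ P : PrincipalStructure π, ∃ Φ : P.G ≃* AutOver π,
      ∀ (g : P.G) (x : M), FMn.fn (Φ g : Aut M).hom x = g • x := by
  refine ⟨?_, fun P => ⟨P.autOverEquiv hM, fun _ _ => rfl⟩⟩
  tfae_have 1 → 3 := by
    rintro ⟨_, _, _, _, G, α, hα⟩
    exact ⟨GroupObjectAction.toPrincipalStructure
      (GroupObjectAction.isKernelPair_of_isSplitting hα) hsurj hsubm hrank⟩
  tfae_have 3 → 4 := fun h => ⟨h, fun P Q => P.isomorphic hM Q⟩
  tfae_have 4 → 3 := fun h => h.1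
  tfae_have 3 → 2 := fun ⟨P⟩ => P.isGaloisEpimorphism hM hsurj hsubm hrank
  tfae_have 2 → 1 := by
    rintro ⟨-, ⟨G, α, ⟨K, s, t, h, hα⟩, -⟩, -⟩
    exact ⟨K, s, t, h, G, α, hα⟩
  tfae_finish
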